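/- An instance consists of items $\mathcal I=\{1,\dots,n\}$, a capacity $B\in\mathbb N$, weights $w_i\in\{1,\dots,B\}$, profits $p_i\ge 0$, and for each item an uncertainty interval containing $p_i$, which is either an open interval $(L_i,U_i)$ or the trivial interval $\{p_i\}$ (then $L_i=U_i=p_i$). Let $p^*$ be the maximum of $\sum_{i\in P}p_i$ over all $P\subseteq\mathcal I$ with $\sum_{i\in P}w_i\le B$, and let $D\ge p^*$ be a threshold. All numbers $p_i,L_i,U_i,D$ are rational, and the input is encoded in binary. For $Q\subseteq\mathcal I$ put $U_i(Q)=p_i$ if $i\in Q$ and $U_i(Q)=U_i$ otherwise, and $U_S(Q)=\sum_{i\in S}U_i(Q)$ for $S\subseteq\mathcal I$. Order the items by non-increasing optimistic density $U_i(Q)/w_i$, where ties are broken by an arbitrary but fixed total order on the items that does not depend on $Q$ and is given with the input. Let $\bar F(Q)$ be the maximal prefix of this order whose total weight is at most $B$. The prefix problem asks for a set $Q\subseteq\mathcal I$ of minimum cardinality such that $U_{\bar F(Q)}(Q)\le D$; let $Q^*_F$ denote an optimal solution. Then there is a polynomial-time algorithm that, given such an instance, computes a set $Q\subseteq\mathcal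 I$ with $|Q|\le|Q^*_F|$ and $$U_{\bar F(Q)}(Q)\le D+2\cdot\max_{i\in\mathcal I}U_i .$$ (For $n=0$ the maximum is read as $0$.) Polynomial time means that the cost of the run is bounded by a polynomial in the number of bits of the input, on a random access machine with integer addition, subtraction, multiplication and comparison under the logarithmic (bit) cost measure. -/

import Mathlib

/-! ## Machine model: random access machine programs with logarithmic (bit) cost -/

namespace RAM

/-- Number of bits needed to write the integer `z` (binary digits of `|z|` plus one sign bit). -/
def bits (z : ℤ) : ℕ := z.natAbs.size + 1

/-- A machine state: integer registers, and integer memories (arrays) with random access. -/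
structure State where
  reg : ℕ → ℤ
  mem : ℕ → ℤ → ℤ

/-- Arithmetic expressions: integer constants, registers, a memory cell whose address is computed
(indirect addressing), sums, differences, products, and the comparison `≤` (with value 0 or 1). -/
inductive Expr where
  | const (z : ℤ)
  | reg (r : ℕ)
  | cell (a : ℕ) (e : Expr)
  | add (e₁ e₂ : Expr)
  | sub (e₁ e₂ : Expr)
  | mul (e₁ e₂ : Expr)
  | le (e₁ e₂ : Expr)

/-- The value of an expression. -/
def Expr.eval (s : State) : Expr → ℤ
  | .const z => z
  | .reg r => s.reg r
  | .cell a e => s.mem a (e.eval s)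
  | .add e₁ e₂ => e₁.eval s + e₂.eval s
  | .sub e₁ e₂ => e₁.eval s - e₂.eval s
  | .mul e₁ e₂ => e₁.eval s * e₂.eval s
  | .le e₁ e₂ => if e₁.eval s ≤ e₂.eval s then 1 else 0

/-- The cost of evaluating an expression: every elementary operation costs one plus the bit lengths
of all numbers (operands, addresses and cell contents) that it handles. -/
def Expr.cost (s : State) : Expr → ℕ
  | .const z => 1 + bits z
  | .reg r => 1 + bits (s.reg r)
  | .cell a e => e.cost s + (1 + bits (e.eval s) + bits (s.mem a (e.eval s)))
  | .add e₁ e₂ => e₁.cost s + e₂.cost s + (1 + bits (e₁.eval s) + bits (e₂.eval s))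
  | .sub e₁ e₂ => e₁.cost s + e₂.cost s + (1 + bits (e₁.eval s) + bits (e₂.eval s))
  | .mul e₁ e₂ => e₁.cost s + e₂.cost s + (1 + bits (e₁.eval s) + bits (e₂.eval s))
  | .le e₁ e₂ => e₁.cost s + e₂.cost s + (1 + bits (e₁.eval s) + bits (e₂.eval s))

/-- Programs. A condition `e` counts as true when its value is nonzero. -/
inductive Prog where
  | skip
  | assign (r : ℕ) (e : Expr)
  | store (a : ℕ) (addr e : Expr)
  | seq (p q : Prog)
  | ite (e : Expr) (p q : Prog)
  | while (e : Expr) (p : Prog)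

/-- Write the value `z` into register `r`. -/
def State.setReg (s : State) (r : ℕ) (z : ℤ) : State :=
  { s with reg := Function.update s.reg r z }

/-- Write the value `z` into the cell of memory `a` with address `k`. -/
def State.setMem (s : State) (a : ℕ) (k z : ℤ) : State :=
  { s with mem := Function.update s.mem a (Function.update (s.mem a) k z) }

/-- `Exec p s s' t`: started in state `s`, the program `p` halts in state `s'` after a run of total
cost exactly `t`. -/
inductive Exec : Prog → State → State → ℕ → Prop where
  | skip (s : State) : Exec .skip s s 1
  | assign (r : ℕ) (e : Expr) (s : State) :
      Exec (.assign r e) s (s.setReg r (e.eval s)) (e.cost s + (1 + bits (e.eval s)))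
  | store (a : ℕ) (addr e : Expr) (s : State) :
      Exec (.store a addr e) s (s.setMem a (addr.eval s) (e.eval s))
        (addr.cost s + e.cost s + (1 + bits (addr.eval s) + bits (e.eval s)))
  | seq {p q : Prog} {s s₁ s₂ : State} {t₁ t₂ : ℕ} :
      Exec p s s₁ t₁ → Exec q s₁ s₂ t₂ → Exec (.seq p q) s s₂ (1 + t₁ + t₂)
  | ite_true {e : Expr} {p q : Prog} {s s' : State} {t : ℕ} :
      e.eval s ≠ 0 → Exec p s s' t → Exec (.ite e p q) s s' (1 + e.cost s + t)
  | ite_false {e : Expr} {p q : Prog} {s s' : State} {t : ℕ} :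
      e.eval s = 0 → Exec q s s' t → Exec (.ite e p q) s s' (1 + e.cost s + t)
  | while_true {e : Expr} {p : Prog} {s s₁ s₂ : State} {t₁ t₂ : ℕ} :
      e.eval s ≠ 0 → Exec p s s₁ t₁ → Exec (.while e p) s₁ s₂ t₂ →
        Exec (.while e p) s s₂ (1 + e.cost s + t₁ + t₂)
  | while_false {e : Expr} {p : Prog} {s : State} :
      e.eval s = 0 → Exec (.while e p) s s (1 + e.cost s)

/-- Programs are deterministic: final state and cost are determined by the initial state. -/
theorem Exec.unique {p : Prog} {s s₁ s₂ : State} {t₁ t₂ : ℕ}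
    (h₁ : Exec p s s₁ t₁) (h₂ : Exec p s s₂ t₂) : s₁ = s₂ ∧ t₁ = t₂ := by
  induction h₁ generalizing s₂ t₂ with
  | skip | assign | store => cases h₂; exact ⟨rfl, rfl⟩
  | seq _ _ ih₁ ih₂ =>
    cases h₂ with
    | seq a b =>
      obtain ⟨rfl, rfl⟩ := ih₁ a
      obtain ⟨rfl, rfl⟩ := ih₂ b
      exact ⟨rfl, rfl⟩
  | ite_true h _ ih =>
    cases h₂ with
    | ite_true _ a => obtain ⟨rfl, rfl⟩ := ih a; exact ⟨rfl, rfl⟩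
    | ite_false h' _ => exact absurd h' h
  | ite_false h _ ih =>
    cases h₂ with
    | ite_true h' _ => exact absurd h h'
    | ite_false _ a => obtain ⟨rfl, rfl⟩ := ih a; exact ⟨rfl, rfl⟩
  | while_true h _ _ ih₁ ih₂ =>
    cases h₂ with
    | while_true _ a b =>
      obtain ⟨rfl, rfl⟩ := ih₁ a
      obtain ⟨rfl, rfl⟩ := ih₂ b
      exact ⟨rfl, rfl⟩
    | while_false h' => exact absurd h' h
  | while_false h =>
    cases h₂ with
    | while_true h' _ _ => exact absurd h h'
    | while_false _ => exact ⟨rfl, rfl⟩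

/-- The initial state on an input list of integers: register 0 holds the length of the list, cells
`0, 1, …` of memory 0 hold its entries, and everything else is zero. -/
def load (l : List ℤ) : State where
  reg := fun r => if r = 0 then (l.length : ℤ) else 0
  mem := fun a k => if a = 0 ∧ 0 ≤ k then l.getD k.toNat 0 else 0

/-- The output: the first `m` cells of memory 1, where `m` is the content of register 0. -/
def output (s : State) : List ℤ :=
  (List.range (s.reg 0).toNat).map fun k => s.mem 1 (k : ℤ)

/-- The size of a list of integers: the number of bits of its binary representation. -/
def inputSize (l : List ℤ) : ℕ := (l.map bits).sum

/-- There is a program that, on the encoding of any `x : α`, halts after a run whose cost is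
polynomially bounded in the number of bits of that encoding, with an output `o` such that
`R x o` holds. -/
def PolyTimeSolvable {α : Type} (encode : α → List ℤ) (R : α → List ℤ → Prop) : Prop :=
  ∃ (prog : Prog) (q : Polynomial ℕ), ∀ x : α, ∃ (s : State) (t : ℕ),
    Exec prog (load (encode x)) s t ∧ t ≤ q.eval (inputSize (encode x)) ∧ R x (output s)

end RAM

/-! ## Offline knapsack under explorable uncertainty and the prefix problem -/

namespace KnapExp

/-- An instance with items `0, …, n - 1`, capacity `B`, weights `w`, profits `p` and uncertainty
intervals. The interval of item `i` is the open interval `(L i, U i)`, or it is trivial, that is, it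
equals `{p i}`, in which case `L i = U i = p i`. All data are rational, so that they can be the
input of an algorithm. -/
structure Instance where
  n : ℕ
  B : ℕ
  w : Fin n → ℕ
  p : Fin n → ℚ
  L : Fin n → ℚ
  U : Fin n → ℚ
  w_pos : ∀ i, 0 < w i
  w_le : ∀ i, w i ≤ B
  p_nonneg : ∀ i, 0 ≤ p i
  p_mem : ∀ i, (L i < p i ∧ p i < U i) ∨ (L i = p i ∧ U i = p i)

namespace Instance

variable (K : Instance)

/-- The weight `w(S)` of a set of items. -/
def weight (S : Finset (Fin K.n)) : ℕ := ∑ i ∈ S, K.w i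

/-- The profit `p(S)` of a set of items. -/
def profit (S : Finset (Fin K.n)) : ℚ := ∑ i ∈ S, K.p i

/-- The packings: sets of items of total weight at most `B`. -/
def packings : Finset (Finset (Fin K.n)) := Finset.univ.filter fun P => K.weight P ≤ K.B

theorem empty_mem_packings : ∅ ∈ K.packings :=
  Finset.mem_filter.2 ⟨Finset.mem_univ _, by simp [weight]⟩

/-- The optimal profit `p*` of the underlying knapsack instance. -/
def optProfit : ℚ := K.packings.sup' ⟨∅, K.empty_mem_packings⟩ K.profit

/-- The upper limit `U_i(Q)` of item `i` after querying `Q`. -/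
def upper (Q : Finset (Fin K.n)) (i : Fin K.n) : ℚ := if i ∈ Q then K.p i else K.U i

/-- The upper limit `U_S(Q)` of a set `S` of items after querying `Q`. -/
def upperSum (S Q : Finset (Fin K.n)) : ℚ := ∑ i ∈ S, K.upper Q i

/-- The largest initial upper limit (zero if there are no items; upper limits are nonnegative). -/
def maxUpper : ℚ := Finset.univ.fold max 0 K.U

/-- The optimistic density of item `i` after querying `Q`: it is `p i / w i` if `i ∈ Q` and
`U i / w i` otherwise. -/
def density (Q : Finset (Fin K.n)) (i : Fin K.n) : ℚ := K.upper Q i / K.w i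

end Instance

/-- An instance of the prefix problem: an offline instance, a tie-breaking rule between the items
(items of smaller rank come first), and a threshold `D ≥ p*`. -/
structure PrefixInstance extends Instance where
  rank : Equiv.Perm (Fin n)
  D : ℚ
  opt_le : toInstance.optProfit ≤ D

namespace PrefixInstance

variable (K : PrefixInstance)

/-- The optimistic density order after querying `Q`, with ties broken by rank:
`i` comes before `j`, or `i = j`. -/
def Before (Q : Finset (Fin K.n)) (i j : Fin K.n) : Prop :=
  K.density Q j < K.density Q i ∨ (K.density Q i = K.density Q j ∧ K.rank i ≤ K.rank j)

instance (Q : Finset (Fin K.n)) (i j : Fin K.n) : Decidable (K.Before Q i j) := by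
  unfold Before; infer_instance

/-- `S` is a prefix (initial segment) of the optimistic density order after querying `Q`. -/
def IsPrefix (Q S : Finset (Fin K.n)) : Prop := ∀ i ∈ S, ∀ j, K.Before Q j i → j ∈ S

/-- The optimistic prefix `F_C(Q)`: the items `i` such that all items up to and including `i` in the
optimistic density order after querying `Q` have total weight at most `C`. -/
def optPrefix (C : ℕ) (Q : Finset (Fin K.n)) : Finset (Fin K.n) :=
  Finset.univ.filter fun i => K.weight (Finset.univ.filter fun j => K.Before Q j i) ≤ C

theorem Before.refl (Q : Finset (Fin K.n)) (i : Fin K.n) : K.Before Q i i := Or.inr ⟨rfl, le_rfl⟩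

theorem Before.trans {Q : Finset (Fin K.n)} {i j k : Fin K.n}
    (h₁ : K.Before Q i j) (h₂ : K.Before Q j k) : K.Before Q i k := by
  rcases h₁ with h₁ | ⟨h₁, h₁'⟩ <;> rcases h₂ with h₂ | ⟨h₂, h₂'⟩
  · exact Or.inl (h₂.trans h₁)
  · exact Or.inl (h₂ ▸ h₁)
  · exact Or.inl (h₁ ▸ h₂)
  · exact Or.inr ⟨h₁.trans h₂, h₁'.trans h₂'⟩

theorem Before.total (Q : Finset (Fin K.n)) (i j : Fin K.n) :
    K.Before Q i j ∨ K.Before Q j i := by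
  rcases lt_trichotomy (K.density Q i) (K.density Q j) with h | h | h
  · exact Or.inr (Or.inl h)
  · rcases le_total (K.rank i) (K.rank j) with h' | h'
    · exact Or.inl (Or.inr ⟨h, h'⟩)
    · exact Or.inr (Or.inr ⟨h.symm, h'⟩)
  · exact Or.inl (Or.inl h)

theorem Before.antisymm {Q : Finset (Fin K.n)} {i j : Fin K.n}
    (h₁ : K.Before Q i j) (h₂ : K.Before Q j i) : i = j := by
  rcases h₁ with h₁ | ⟨h₁, h₁'⟩ <;> rcases h₂ with h₂ | ⟨h₂, h₂'⟩
  · exact absurd h₁ h₂.asymm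
  · exact absurd h₁ (by rw [h₂]; exact lt_irrefl _)
  · exact absurd h₂ (by rw [h₁]; exact lt_irrefl _)
  · exact K.rank.injective (le_antisymm h₁' h₂')

/-- `F_C(Q)` is the maximal prefix of the optimistic density order of weight at most `C`. -/
theorem isGreatest_optPrefix (C : ℕ) (Q : Finset (Fin K.n)) :
    IsGreatest {S | K.IsPrefix Q S ∧ K.weight S ≤ C} (K.optPrefix C Q) := by
  have mono : ∀ {S T : Finset (Fin K.n)}, S ⊆ T → K.weight S ≤ K.weight T := fun h =>
    Finset.sum_le_sum_of_subset h
  refine ⟨⟨?_, ?_⟩, ?_⟩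
  · intro i hi j hj
    simp only [optPrefix, Finset.mem_filter, Finset.mem_univ, true_and] at hi ⊢
    refine (mono ?_).trans hi
    intro k hk
    simp only [Finset.mem_filter, Finset.mem_univ, true_and] at hk ⊢
    exact Before.trans K hk hj
  · have key : ∀ T : Finset (Fin K.n), T.Nonempty → ∃ m ∈ T, ∀ i ∈ T, K.Before Q i m := by
      intro T hT
      induction hT using Finset.Nonempty.cons_induction with
      | singleton a => exact ⟨a, by simp, by simpa using Before.refl K Q a⟩
      | cons a T ha hT ih =>
        obtain ⟨m, hm, h⟩ := ih
        rcases Before.total K Q a m with h' | h'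
        · refine ⟨m, by simp [hm], fun i hi => ?_⟩
          rcases Finset.mem_cons.1 hi with rfl | hi
          exacts [h', h i hi]
        · refine ⟨a, by simp, fun i hi => ?_⟩
          rcases Finset.mem_cons.1 hi with rfl | hi
          exacts [Before.refl K Q i, Before.trans K (h i hi) h']
    rcases (K.optPrefix C Q).eq_empty_or_nonempty with h | h
    · rw [h]; simp [Instance.weight]
    · obtain ⟨m, hm, hmax⟩ := key _ h
      refine (mono fun i hi => ?_).trans (Finset.mem_filter.1 hm).2
      simpa using hmax i hi
  · rintro S ⟨hS, hw⟩ i hi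
    simp only [optPrefix, Finset.mem_filter, Finset.mem_univ, true_and]
    refine (mono fun j hj => ?_).trans hw
    simp only [Finset.mem_filter, Finset.mem_univ, true_and] at hj
    exact hS i hi j hj

/-- The value `U_{F(Q)}(Q)`, where `F(Q) = F_B(Q)`. -/
def prefixValue (Q : Finset (Fin K.n)) : ℚ := K.upperSum (K.optPrefix K.B Q) Q

/-- `Q` is a feasible solution of the prefix problem. -/
def IsFeasible (Q : Finset (Fin K.n)) : Prop := K.prefixValue Q ≤ K.D

/-- `Q` is an optimal solution of the prefix problem: a feasible one of minimum cardinality. -/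
def IsOptimal (Q : Finset (Fin K.n)) : Prop :=
  K.IsFeasible Q ∧ ∀ Q', K.IsFeasible Q' → Q.card ≤ Q'.card

/-- Optimal solutions exist. -/
theorem exists_isOptimal : ∃ Q, K.IsOptimal Q := by
  have hne : K.IsFeasible Finset.univ := by
    refine le_trans ?_ K.opt_le
    have h : K.optPrefix K.B Finset.univ ∈ K.packings := by
      simpa [Instance.packings] using (K.isGreatest_optPrefix K.B Finset.univ).1.2
    have := Finset.le_sup' K.profit h
    simpa [prefixValue, Instance.upperSum, Instance.upper, Instance.profit,
      Instance.optProfit] using this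
  obtain ⟨Q, hQ, hmin⟩ := Set.exists_min_image {Q | K.IsFeasible Q} Finset.card
    (Set.toFinite _) ⟨_, hne⟩
  exact ⟨Q, hQ, hmin⟩

/-- The input encoding: a list of integers, where rational numbers are given by numerators and
denominators. -/
def encode : List ℤ :=
  [(K.n : ℤ), (K.B : ℤ), K.D.num, (K.D.den : ℤ)] ++
    (List.finRange K.n).flatMap fun i =>
      [(K.w i : ℤ), (K.p i).num, ((K.p i).den : ℤ), (K.L i).num, ((K.L i).den : ℤ),
        (K.U i).num, ((K.U i).den : ℤ), ((K.rank i : ℕ) : ℤ)]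

/-- The output encoding of a set of items: its 0/1 incidence vector. -/
def encodeSet (Q : Finset (Fin K.n)) : List ℤ := List.ofFn fun i => if i ∈ Q then 1 else 0

end PrefixInstance

end KnapExp

/-! Fix a density λ ≥ 0. Relaxing the capacity constraint in the Lagrangian way bounds the prefix
value by λB + Σ_i max(0, U_i(Q) - λ w_i). This sum is separable over the items. For a prescribed
number of queries it is smallest when the items with the largest gains are queried, the gain being
the decrease of an item's excess.

Let Q be feasible and let s be the first item outside its prefix F. At λ = U_s(Q)/w_s the excess is
U_i(Q) - λ w_i on F and 0 elsewhere, and B - w_s < w(F). Hence λ(B - w_s) plus the total excess is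
at most U_F(Q) ≤ D (`exists_sum_excess_le`). If all items fit, λ = 0 works. So only the densities
p_s/w_s, U_s/w_s and 0 have to be tried.

Conversely, a set that passes this test has prefix value at most D + λ w_s ≤ D + max U
(`prefixValue_le_of_excess_le`); one maximum is already enough. Replacing a feasible Q by the set of
largest gains of the same size preserves the test (`sum_le_sum_topBefore`, `exists_pass`), so a
smallest passing set is no larger than an optimal solution.

The program enumerates the densities and an item j, and tests the set of items whose gain precedes
that of j. These sets realise every size below n (`exists_card_topBefore`); the full set is the
default. All comparisons are cross-multiplied into integers. For the running time, the rules for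
`Runs` reduce everything to bounds on bit lengths and on loop lengths. The only numbers that keep
growing are the numerator and denominator of the accumulated excess, and each item adds a number of
bits linear in the input size (`abs_accumulate_le`). -/

namespace RAM

/-! ### Bit lengths and the cost of expressions -/

theorem one_le_bits (z : ℤ) : 1 ≤ bits z := Nat.le_add_left _ _

theorem bits_le_succ_iff {z : ℤ} {k : ℕ} : bits z ≤ k + 1 ↔ |z| < 2 ^ k := by
  rw [bits, Nat.add_le_add_iff_right, Nat.size_le, Int.abs_eq_natAbs]
  exact_mod_cast Iff.rfl

theorem abs_lt_of_bits_le {z : ℤ} {k : ℕ} (h : bits z ≤ k) : |z| < 2 ^ k :=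
  bits_le_succ_iff.1 (h.trans (Nat.le_succ k))

theorem bits_add_le (x y : ℤ) : bits (x + y) ≤ bits x + bits y := by
  have hx := one_le_bits x
  have hy := one_le_bits y
  obtain ⟨a, ha⟩ : ∃ a, bits x = a + 1 := ⟨bits x - 1, by omega⟩
  obtain ⟨b, hb⟩ : ∃ b, bits y = b + 1 := ⟨bits y - 1, by omega⟩
  have h1 := bits_le_succ_iff.1 ha.le
  have h2 := bits_le_succ_iff.1 hb.le
  rw [show bits x + bits y = (a + b + 1) + 1 by omega, bits_le_succ_iff]
  have h3 : (2 : ℤ) ^ a ≤ 2 ^ (a + b) := pow_le_pow_right₀ (by norm_num) (by omega)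
  have h4 : (2 : ℤ) ^ b ≤ 2 ^ (a + b) := pow_le_pow_right₀ (by norm_num) (by omega)
  have := abs_add_le x y
  rw [pow_succ]
  linarith

theorem bits_neg (x : ℤ) : bits (-x) = bits x := by simp [bits]

theorem bits_sub_le (x y : ℤ) : bits (x - y) ≤ bits x + bits y := by
  simpa [sub_eq_add_neg, bits_neg] using bits_add_le x (-y)

theorem bits_mul_le (x y : ℤ) : bits (x * y) ≤ bits x + bits y := by
  have hx := one_le_bits x
  have hy := one_le_bits y
  obtain ⟨a, ha⟩ : ∃ a, bits x = a + 1 := ⟨bits x - 1, by omega⟩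
  obtain ⟨b, hb⟩ : ∃ b, bits y = b + 1 := ⟨bits y - 1, by omega⟩
  have h1 := bits_le_succ_iff.1 ha.le
  have h2 := bits_le_succ_iff.1 hb.le
  refine le_trans (?_ : bits (x * y) ≤ (a + b) + 1) (by omega)
  rw [bits_le_succ_iff, abs_mul, pow_add]
  exact mul_lt_mul'' h1 h2 (abs_nonneg _) (abs_nonneg _)

/-- Linear in the value instead of logarithmic. This suffices, since it is only applied to counters
and lengths that the input size already bounds. -/
theorem bits_le_of_nonneg_of_le {z : ℤ} {k : ℕ} (h0 : 0 ≤ z) (hk : z ≤ k) : bits z ≤ k + 1 := by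
  rw [bits_le_succ_iff, abs_of_nonneg h0]
  exact hk.trans_lt (by exact_mod_cast Nat.lt_two_pow_self)

/-- All registers and memory cells hold numbers of at most `b` bits. -/
structure Bdd (b : ℕ) (s : State) : Prop where
  reg : ∀ r, bits (s.reg r) ≤ b
  mem : ∀ a k, bits (s.mem a k) ≤ b

theorem Bdd.one_le {b : ℕ} {s : State} (h : Bdd b s) : 1 ≤ b := (one_le_bits _).trans (h.reg 0)

/-- A constant bounding both the growth and the evaluation cost of an expression. -/
def Expr.factor : Expr → ℕ
  | .const z => 1 + bits z
  | .reg _ => 2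
  | .cell _ e => 2 * e.factor + 2
  | .add e₁ e₂ => 2 * e₁.factor + 2 * e₂.factor + 2
  | .sub e₁ e₂ => 2 * e₁.factor + 2 * e₂.factor + 2
  | .mul e₁ e₂ => 2 * e₁.factor + 2 * e₂.factor + 2
  | .le e₁ e₂ => 2 * e₁.factor + 2 * e₂.factor + 2

/-- Sums and products at most add up the bit lengths of their operands, so a fixed expression is
linear in `b` in both size and cost. The two bounds are proved together because the cost of a node
includes the sizes of its operands; `1 ≤ b` absorbs the constants. -/
theorem Expr.bits_eval_le_and_cost_le {b : ℕ} {s : State} (h : Bdd b s) (e : Expr) :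
    bits (e.eval s) ≤ e.factor * b ∧ e.cost s ≤ e.factor * b := by
  have hb := h.one_le
  induction e with
  | const z =>
    have : (1 + bits z) * 1 ≤ (1 + bits z) * b := Nat.mul_le_mul_left _ hb
    simp only [Expr.eval, Expr.cost, Expr.factor]; omega
  | reg r =>
    have := h.reg r
    simp only [Expr.eval, Expr.cost, Expr.factor]; omega
  | cell a e ih =>
    have := h.mem a (e.eval s)
    have : (2 * e.factor + 2) * b = 2 * (e.factor * b) + 2 * b := by ring
    simp only [Expr.eval, Expr.cost, Expr.factor]; omega
  | add e₁ e₂ ih₁ ih₂ =>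
    have := bits_add_le (e₁.eval s) (e₂.eval s)
    have : (2 * e₁.factor + 2 * e₂.factor + 2) * b
      = 2 * (e₁.factor * b) + 2 * (e₂.factor * b) + 2 * b := by ring
    simp only [Expr.eval, Expr.cost, Expr.factor]; omega
  | sub e₁ e₂ ih₁ ih₂ =>
    have := bits_sub_le (e₁.eval s) (e₂.eval s)
    have : (2 * e₁.factor + 2 * e₂.factor + 2) * b
      = 2 * (e₁.factor * b) + 2 * (e₂.factor * b) + 2 * b := by ring
    simp only [Expr.eval, Expr.cost, Expr.factor]; omega
  | mul e₁ e₂ ih₁ ih₂ =>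
    have := bits_mul_le (e₁.eval s) (e₂.eval s)
    have : (2 * e₁.factor + 2 * e₂.factor + 2) * b
      = 2 * (e₁.factor * b) + 2 * (e₂.factor * b) + 2 * b := by ring
    simp only [Expr.eval, Expr.cost, Expr.factor]; omega
  | le e₁ e₂ ih₁ ih₂ =>
    have : bits (if e₁.eval s ≤ e₂.eval s then 1 else 0) ≤ 2 := by split_ifs <;> simp [bits]
    have : (2 * e₁.factor + 2 * e₂.factor + 2) * b
      = 2 * (e₁.factor * b) + 2 * (e₂.factor * b) + 2 * b := by ring
    simp only [Expr.eval, Expr.cost, Expr.factor]; omega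

theorem Expr.bits_eval_le {b : ℕ} {s : State} (h : Bdd b s) (e : Expr) :
    bits (e.eval s) ≤ e.factor * b := (e.bits_eval_le_and_cost_le h).1

theorem Expr.cost_le {b : ℕ} {s : State} (h : Bdd b s) (e : Expr) :
    e.cost s ≤ e.factor * b := (e.bits_eval_le_and_cost_le h).2

/-- A bound for the running time of a program, if all numbers that occur have at most `b` bits and
every loop makes at most `N` iterations. -/
def Prog.time (b N : ℕ) : Prog → ℕ
  | .skip => 1
  | .assign _ e => 2 * e.factor * b + 1
  | .store _ d e => 2 * (d.factor + e.factor) * b + 1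
  | .seq p q => 1 + p.time b N + q.time b N
  | .ite e p q => 1 + e.factor * b + (p.time b N + q.time b N)
  | .while e p => (N + 1) * (1 + e.factor * b + p.time b N)

/-- The program is fixed, so each level of loop nesting only multiplies by a polynomial factor, and
the bit bound `b` is itself polynomial in `N`. -/
theorem Prog.exists_polynomial_time (β : Polynomial ℕ) (p : Prog) :
    ∃ q : Polynomial ℕ, ∀ N, q.eval N = p.time (β.eval N) N := by
  induction p with
  | skip => exact ⟨1, fun N => by simp [Prog.time]⟩
  | assign r e =>
    exact ⟨.C (2 * e.factor) * β + 1, fun N => by simp [Prog.time]⟩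
  | store a d e =>
    exact ⟨.C (2 * (d.factor + e.factor)) * β + 1, fun N => by simp [Prog.time]⟩
  | seq p q ihp ihq =>
    obtain ⟨f, hf⟩ := ihp
    obtain ⟨g, hg⟩ := ihq
    exact ⟨1 + f + g, fun N => by simp [Prog.time, hf, hg]⟩
  | ite e p q ihp ihq =>
    obtain ⟨f, hf⟩ := ihp
    obtain ⟨g, hg⟩ := ihq
    exact ⟨1 + .C e.factor * β + (f + g), fun N => by simp [Prog.time, hf, hg]⟩
  | _ e p ih =>
    obtain ⟨f, hf⟩ := ih
    exact ⟨(.X + 1) * (1 + .C e.factor * β + f), fun N => by simp [Prog.time, hf]⟩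

/-! ### Program logic with time bounds -/

/-- Started in `s`, the program halts in a state satisfying `Q`, within the time allowed by
`Prog.time b N`. -/
def Runs (b N : ℕ) (p : Prog) (s : State) (Q : State → Prop) : Prop :=
  ∃ s' t, Exec p s s' t ∧ t ≤ p.time b N ∧ Q s'

variable {b N : ℕ}

theorem Runs.mono {p : Prog} {s : State} {Q Q' : State → Prop} (h : Runs b N p s Q)
    (hQ : ∀ s', Q s' → Q' s') : Runs b N p s Q' := by
  obtain ⟨s', t, he, ht, hq⟩ := h
  exact ⟨s', t, he, ht, hQ _ hq⟩

theorem Runs.skip {s : State} {Q : State → Prop} (h : Q s) : Runs b N .skip s Q :=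
  ⟨s, 1, .skip s, le_rfl, h⟩

theorem Runs.assign {r : ℕ} {e : Expr} {s : State} {Q : State → Prop} (hb : Bdd b s)
    (h : Q (s.setReg r (e.eval s))) : Runs b N (.assign r e) s Q := by
  refine ⟨_, _, .assign r e s, ?_, h⟩
  have h1 := e.bits_eval_le hb
  have h2 := e.cost_le hb
  have : 2 * e.factor * b = 2 * (e.factor * b) := by ring
  simp only [Prog.time]
  omega

theorem Runs.store {m : ℕ} {d e : Expr} {s : State} {Q : State → Prop} (hb : Bdd b s)
    (h : Q (s.setMem m (d.eval s) (e.eval s))) : Runs b N (.store m d e) s Q := by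
  refine ⟨_, _, .store m d e s, ?_, h⟩
  have h1 := e.bits_eval_le hb
  have h2 := e.cost_le hb
  have h3 := d.bits_eval_le hb
  have h4 := d.cost_le hb
  have : 2 * (d.factor + e.factor) * b = 2 * (d.factor * b) + 2 * (e.factor * b) := by ring
  simp only [Prog.time]
  omega

theorem Runs.seq {p q : Prog} {s : State} {Q : State → Prop}
    (h : Runs b N p s fun s' => Runs b N q s' Q) : Runs b N (.seq p q) s Q := by
  obtain ⟨s₁, t₁, he₁, ht₁, s₂, t₂, he₂, ht₂, hq⟩ := h
  exact ⟨s₂, _, .seq he₁ he₂, by simp only [Prog.time]; omega, hq⟩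

theorem Runs.ite {e : Expr} {p q : Prog} {s : State} {Q : State → Prop}
    (hb : Bdd b s) (h₁ : e.eval s ≠ 0 → Runs b N p s Q) (h₂ : e.eval s = 0 → Runs b N q s Q) :
    Runs b N (.ite e p q) s Q := by
  have h := e.cost_le hb
  by_cases h0 : e.eval s = 0
  · obtain ⟨s', t, he, ht, hq⟩ := h₂ h0
    exact ⟨s', _, .ite_false h0 he, by simp only [Prog.time]; omega, hq⟩
  · obtain ⟨s', t, he, ht, hq⟩ := h₁ h0
    exact ⟨s', _, .ite_true h0 he, by simp only [Prog.time]; omega, hq⟩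

/-- A loop with invariant `I` that makes exactly `n` iterations. -/
theorem Runs.loop {e : Expr} {p : Prog} {n : ℕ} (hn : n ≤ N) {I : ℕ → State → Prop}
    (hc : ∀ k ≤ n, ∀ s, I k s → Bdd b s ∧ (e.eval s ≠ 0 ↔ k < n))
    (hp : ∀ k < n, ∀ s, I k s → Runs b N p s (I (k + 1))) {s : State} (h : I 0 s) :
    Runs b N (.while e p) s (I n) := by
  have key : ∀ d k s, k + d = n → I k s → ∃ s' t, Exec (.while e p) s s' t ∧
      t ≤ (d + 1) * (1 + e.factor * b + p.time b N) ∧ I n s' := by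
    intro d
    induction d with
    | zero =>
      rintro k s rfl hI
      obtain ⟨h1, h2⟩ := hc k le_rfl s hI
      refine ⟨s, _, .while_false ?_, ?_, hI⟩
      · by_contra h0; exact absurd (h2.1 h0) (lt_irrefl _)
      · have := e.cost_le h1; omega
    | succ d ih =>
      intro k s hk hI
      obtain ⟨h1, h2⟩ := hc k (by omega) s hI
      have h1 := e.cost_le h1
      obtain ⟨s₁, t₁, he₁, ht₁, hI₁⟩ := hp k (by omega) s hI
      obtain ⟨s₂, t₂, he₂, ht₂, hI₂⟩ := ih (k + 1) s₁ (by omega) hI₁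
      refine ⟨s₂, _, .while_true (h2.2 (by omega)) he₁ he₂, ?_, hI₂⟩
      rw [add_mul (d + 1), one_mul]
      omega
  obtain ⟨s', t, he, ht, hI⟩ := key n 0 s (by omega) h
  exact ⟨s', t, he, ht.trans (Nat.mul_le_mul_right _ (by omega)), hI⟩

end RAM

namespace KnapExp.PrefixInstance

/-! ### Lagrangian duality for the optimistic prefix -/

variable (K : PrefixInstance)

theorem U_le_maxUpper (i : Fin K.n) : K.U i ≤ K.maxUpper :=
  (Finset.le_fold_max _).2 (Or.inr ⟨i, Finset.mem_univ i, le_rfl⟩)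

theorem maxUpper_nonneg : 0 ≤ K.maxUpper := (Finset.le_fold_max _).2 (Or.inl le_rfl)

theorem p_le_U (i : Fin K.n) : K.p i ≤ K.U i := by
  rcases K.p_mem i with h | h
  · exact h.2.le
  · exact h.2.ge

theorem upper_nonneg (Q : Finset (Fin K.n)) (i : Fin K.n) : 0 ≤ K.upper Q i := by
  unfold Instance.upper
  split_ifs
  exacts [K.p_nonneg i, (K.p_nonneg i).trans (K.p_le_U i)]

theorem prefixValue_univ_le : K.prefixValue Finset.univ ≤ K.D := by
  refine le_trans ?_ K.opt_le
  have h : K.optPrefix K.B Finset.univ ∈ K.packings := by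
    simpa [Instance.packings] using (K.isGreatest_optPrefix K.B Finset.univ).1.2
  have := Finset.le_sup' K.profit h
  simpa [prefixValue, Instance.upperSum, Instance.upper, Instance.profit,
    Instance.optProfit] using this

/-- The excess `max (0, c U_i(Q) - N w_i)` of item `i` over the density `N / c`. -/
def excess (c N : ℚ) (Q : Finset (Fin K.n)) (i : Fin K.n) : ℚ :=
  max 0 (c * K.upper Q i - N * K.w i)

/-- Weak duality for the fractional knapsack problem. -/
theorem prefixValue_le_of_excess_le {c N W : ℚ} (hc : 0 < c) (hN : 0 ≤ N) {Q : Finset (Fin K.n)}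
    (hW : N * W ≤ c * K.maxUpper)
    (h : N * (K.B - W) + ∑ i, K.excess c N Q i ≤ K.D * c) :
    K.prefixValue Q ≤ K.D + 2 * K.maxUpper := by
  have hF : K.weight (K.optPrefix K.B Q) ≤ K.B := (K.isGreatest_optPrefix K.B Q).1.2
  set F := K.optPrefix K.B Q with hFdef
  have h1 : c * K.prefixValue Q - N * (K.weight F : ℚ) ≤ ∑ i, K.excess c N Q i := by
    have : c * K.prefixValue Q - N * (K.weight F : ℚ)
        = ∑ i ∈ F, (c * K.upper Q i - N * K.w i) := by
      rw [prefixValue, ← hFdef, Instance.upperSum, Instance.weight]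
      push_cast
      rw [Finset.sum_sub_distrib, Finset.mul_sum, Finset.mul_sum]
    rw [this]
    refine (Finset.sum_le_sum fun i _ => le_max_right 0 _).trans ?_
    exact Finset.sum_le_sum_of_subset_of_nonneg (Finset.subset_univ _) fun i _ _ => le_max_left _ _
  have h2 : N * (K.weight F : ℚ) ≤ N * K.B := by gcongr
  -- The hypothesis charges capacity `B - W` only; the missing `N * W` costs at most one `c *
  -- K.maxUpper`.
  have h3 : c * K.prefixValue Q ≤ c * (K.D + K.maxUpper) := by linarith
  have h4 := le_of_mul_le_mul_left h3 hc
  have := K.maxUpper_nonneg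
  linarith

theorem exists_first {Q A : Finset (Fin K.n)} (hA : A.Nonempty) :
    ∃ m ∈ A, ∀ i ∈ A, K.Before Q m i := by
  induction hA using Finset.Nonempty.cons_induction with
  | singleton a => exact ⟨a, by simp, by simpa using Before.refl K Q a⟩
  | cons a T ha hT ih =>
    obtain ⟨m, hm, h⟩ := ih
    rcases Before.total K Q m a with h' | h'
    · refine ⟨m, by simp [hm], fun i hi => ?_⟩
      rcases Finset.mem_cons.1 hi with rfl | hi
      exacts [h', h i hi]
    · refine ⟨a, by simp, fun i hi => ?_⟩
      rcases Finset.mem_cons.1 hi with rfl | hi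
      exacts [Before.refl K Q i, Before.trans K h' (h i hi)]

theorem density_le_of_before {Q : Finset (Fin K.n)} {i j : Fin K.n} (h : K.Before Q i j) :
    K.density Q j ≤ K.density Q i := by
  rcases h with h | h
  exacts [h.le, h.1.ge]

/-- Strong duality up to the critical item: a feasible set has small total excess over `0` or over
the optimistic density of some item. -/
theorem exists_sum_excess_le {Q : Finset (Fin K.n)} (hQ : K.IsFeasible Q) (hn : 0 < K.n) :
    ∃ (s : Fin K.n) (v : ℚ), (v = K.p s ∨ v = 0 ∨ v = K.U s) ∧ ∀ V : ℚ, 0 < V →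
      v * V * (K.B - K.w s) + ∑ i, K.excess (K.w s * V) (v * V) Q i ≤ K.D * (K.w s * V) := by
  have hw : ∀ i, (0 : ℚ) < K.w i := fun i => by exact_mod_cast K.w_pos i
  set F := K.optPrefix K.B Q with hF
  have hval : ∑ i ∈ F, K.upper Q i ≤ K.D := hQ
  rcases Finset.eq_empty_or_nonempty Fᶜ with hempty | hne
  -- All items fit. At density 0 the capacity term vanishes and the excess is the upper limit
  -- itself; the item only provides a positive scale.
  · refine ⟨⟨0, hn⟩, 0, Or.inr (Or.inl rfl), fun V hV => ?_⟩
    rw [Finset.compl_eq_empty_iff] at hempty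
    rw [hempty] at hval
    have hc := mul_pos (hw ⟨0, hn⟩) hV
    have : ∀ i, K.excess (K.w ⟨0, hn⟩ * V) (0 * V) Q i = (K.w ⟨0, hn⟩ * V) * K.upper Q i := by
      intro i
      rw [excess, zero_mul, zero_mul, sub_zero, max_eq_right]
      exact mul_nonneg hc.le (K.upper_nonneg Q i)
    simp only [this, ← Finset.mul_sum]
    nlinarith
  -- The critical item: items of `F` have at least its density, all others at most that.
  · obtain ⟨s, hs, hmin⟩ := K.exists_first (Q := Q) hne
    have hsF : s ∉ F := Finset.mem_compl.1 hs
    refine ⟨s, K.upper Q s, ?_, fun V hV => ?_⟩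
    · unfold Instance.upper; split_ifs <;> simp
    set v := K.upper Q s with hv
    have hv0 : 0 ≤ v := K.upper_nonneg Q s
    -- `s` was left out, so `s` and its predecessors, all contained in `insert s F`, exceed the
    -- capacity. This is what pays for the term with `B - w s`.
    have hwt : (K.B : ℚ) < K.weight F + K.w s := by
      have h1 : K.B < K.weight (Finset.univ.filter fun j => K.Before Q j s) := by
        by_contra h
        exact hsF (by simpa [hF, optPrefix] using h)
      have h2 : K.weight (Finset.univ.filter fun j => K.Before Q j s) ≤ K.weight (insert s F) := by
        refine Finset.sum_le_sum_of_subset fun j hj => ?_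
        rw [Finset.mem_insert]
        by_contra! h
        exact h.1 (Before.antisymm K (Finset.mem_filter.1 hj).2
          (hmin j (Finset.mem_compl.2 h.2)))
      have h3 : K.weight (insert s F) = K.w s + K.weight F := Finset.sum_insert hsF
      have : K.B < K.weight F + K.w s := by omega
      exact_mod_cast this
    have hcross : ∀ i j, K.density Q i ≤ K.density Q j →
        K.upper Q i * K.w j ≤ K.upper Q j * K.w i := fun i j h => by
      rwa [Instance.density, Instance.density, div_le_div_iff₀ (hw i) (hw j)] at h
    have hin : ∀ i ∈ F, K.excess (K.w s * V) (v * V) Q i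
        = K.w s * V * K.upper Q i - v * V * K.w i := by
      intro i hi
      refine max_eq_right ?_
      have hb : K.Before Q i s := by
        rcases Before.total K Q i s with h | h
        · exact h
        · exact absurd ((K.isGreatest_optPrefix K.B Q).1.1 i hi s h) hsF
      have := mul_le_mul_of_nonneg_right (hcross s i (K.density_le_of_before hb)) hV.le
      linarith
    have hout : ∀ i ∈ Fᶜ, K.excess (K.w s * V) (v * V) Q i = 0 := by
      intro i hi
      refine max_eq_left ?_
      have := mul_le_mul_of_nonneg_right
        (hcross i s (K.density_le_of_before (hmin i hi))) hV.le
      linarith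
    rw [← Finset.sum_add_sum_compl F, Finset.sum_eq_zero hout, Finset.sum_congr rfl hin,
      Finset.sum_sub_distrib, ← Finset.mul_sum, ← Finset.mul_sum, add_zero]
    have hwF : ∑ i ∈ F, (K.w i : ℚ) = K.weight F := by simp [Instance.weight]
    rw [hwF]
    have h1 : K.w s * V * ∑ i ∈ F, K.upper Q i ≤ K.w s * V * K.D :=
      mul_le_mul_of_nonneg_left hval (mul_pos (hw s) hV).le
    have h2 : 0 ≤ v * V * (K.weight F + K.w s - K.B) :=
      mul_nonneg (mul_nonneg hv0 hV.le) (by linarith)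
    linarith

end KnapExp.PrefixInstance

/-! ### Greedy choice of the largest gains -/

/-- The elements that precede `j` when sorted by non-increasing `g`, ties broken by index. -/
def topBefore {n : ℕ} (g : Fin n → ℚ) (j : Fin n) : Finset (Fin n) :=
  Finset.univ.filter fun i => g j < g i ∨ (g i = g j ∧ i < j)

/-- With ties broken by index the order is total, so the position of an element is an injective,
hence surjective, map from `Fin n` to itself. Looping over `j` therefore reaches every size below
`n` without sorting. -/
theorem exists_card_topBefore {n : ℕ} (g : Fin n → ℚ) {k : ℕ} (hk : k < n) :
    ∃ j, (topBefore g j).card = k := by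
  have hlt : ∀ j, (topBefore g j).card < n := fun j => by
    have : topBefore g j ⊂ Finset.univ := by
      rw [Finset.ssubset_univ_iff]
      intro h
      have := h ▸ Finset.mem_univ j
      simp [topBefore] at this
    simpa using Finset.card_lt_card this
  have hmono : ∀ i j, i ∈ topBefore g j → (topBefore g i).card < (topBefore g j).card := by
    intro i j hij
    refine Finset.card_lt_card ⟨fun x hx => ?_, fun h => ?_⟩
    · simp only [topBefore, Finset.mem_filter, Finset.mem_univ, true_and] at hij hx ⊢
      rcases hij with h1 | h1 <;> rcases hx with h2 | h2
      · exact Or.inl (h1.trans h2)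
      · exact Or.inl (h2.1 ▸ h1)
      · exact Or.inl (h1.1 ▸ h2)
      · exact Or.inr ⟨h2.1.trans h1.1, h2.2.trans h1.2⟩
    · have := h hij
      simp [topBefore] at this
  let f : Fin n → Fin n := fun j => ⟨(topBefore g j).card, hlt j⟩
  have hf : Function.Injective f := by
    intro i j hij
    have hij : (topBefore g i).card = (topBefore g j).card := congrArg Fin.val hij
    by_contra hne
    have : i ∈ topBefore g j ∨ j ∈ topBefore g i := by
      simp only [topBefore, Finset.mem_filter, Finset.mem_univ, true_and]
      rcases lt_trichotomy (g i) (g j) with h | h | h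
      · exact Or.inr (Or.inl h)
      · rcases lt_or_gt_of_ne hne with h' | h'
        · exact Or.inl (Or.inr ⟨h, h'⟩)
        · exact Or.inr (Or.inr ⟨h.symm, h'⟩)
      · exact Or.inl (Or.inl h)
    rcases this with h | h
    · exact (hmono _ _ h).ne hij
    · exact (hmono _ _ h).ne hij.symm
  obtain ⟨j, hj⟩ := (Finite.injective_iff_surjective.1 hf) ⟨k, hk⟩
  exact ⟨j, congrArg Fin.val hj⟩

/-- Exchange argument with threshold `g j`: elements of `T \ Q` have value at least `g j`, elements
of `Q \ T` at most `g j`, and there are no more of the latter. Nonnegativity of `g j` handles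
smaller `Q`. -/
theorem sum_le_sum_topBefore {n : ℕ} {g : Fin n → ℚ} (hg : ∀ i, 0 ≤ g i) {j : Fin n}
    {Q : Finset (Fin n)} (hQ : Q.card ≤ (topBefore g j).card) :
    ∑ i ∈ Q, g i ≤ ∑ i ∈ topBefore g j, g i := by
  set T := topBefore g j with hT
  have h1 : ∀ i ∈ T, g j ≤ g i := fun i hi => by
    simp only [hT, topBefore, Finset.mem_filter, Finset.mem_univ, true_and] at hi
    rcases hi with h | h
    exacts [h.le, h.1.ge]
  have h2 : ∀ i ∉ T, g i ≤ g j := fun i hi => by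
    simp only [hT, topBefore, Finset.mem_filter, Finset.mem_univ, true_and, not_or, not_lt] at hi
    exact hi.1
  have hcard : (Q \ T).card ≤ (T \ Q).card := by
    have e1 := Finset.card_sdiff_add_card_inter Q T
    have e2 := Finset.card_sdiff_add_card_inter T Q
    rw [Finset.inter_comm] at e2
    omega
  have e3 : ∑ i ∈ Q \ T, g i ≤ ((Q \ T).card : ℚ) * g j := by
    rw [← nsmul_eq_mul]
    exact Finset.sum_le_card_nsmul _ _ _ fun i hi => h2 i (Finset.mem_sdiff.1 hi).2
  have e4 : ((T \ Q).card : ℚ) * g j ≤ ∑ i ∈ T \ Q, g i := by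
    rw [← nsmul_eq_mul]
    exact Finset.card_nsmul_le_sum _ _ _ fun i hi => h1 i (Finset.mem_sdiff.1 hi).1
  have e5 : ((Q \ T).card : ℚ) * g j ≤ ((T \ Q).card : ℚ) * g j := by
    have := hg j
    gcongr
  have e6 := Finset.sum_inter_add_sum_sdiff Q T g
  have e7 := Finset.sum_inter_add_sum_sdiff T Q g
  rw [Finset.inter_comm] at e7
  linarith

/-! ### Notation and simplification rules for the machine -/

namespace RAM.Expr

instance : Add Expr := ⟨Expr.add⟩
instance : Sub Expr := ⟨Expr.sub⟩
instance : Mul Expr := ⟨Expr.mul⟩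
instance (k : ℕ) : OfNat Expr k := ⟨Expr.const k⟩

@[simp] theorem eval_reg (s : State) (r : ℕ) : (Expr.reg r).eval s = s.reg r := rfl
@[simp] theorem eval_cell (s : State) (a : ℕ) (e : Expr) :
    (Expr.cell a e).eval s = s.mem a (e.eval s) := rfl
@[simp] theorem eval_add (s : State) (x y : Expr) : (x + y).eval s = x.eval s + y.eval s := rfl
@[simp] theorem eval_sub (s : State) (x y : Expr) : (x - y).eval s = x.eval s - y.eval s := rfl
@[simp] theorem eval_mul (s : State) (x y : Expr) : (x * y).eval s = x.eval s * y.eval s := rfl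
@[simp] theorem eval_le (s : State) (x y : Expr) :
    (Expr.le x y).eval s = if x.eval s ≤ y.eval s then 1 else 0 := rfl
@[simp] theorem eval_ofNat (s : State) (k : ℕ) :
    Expr.eval s (no_index (OfNat.ofNat k)) = (OfNat.ofNat k : ℤ) := rfl

/-- The maximum of `0` and the value of `x`. -/
def pos (x : Expr) : Expr := .le 0 x * x

@[simp] theorem eval_pos (s : State) (x : Expr) : (pos x).eval s = max 0 (x.eval s) := by
  by_cases h : 0 ≤ x.eval s
  · simp [pos, h]
  · simp [pos, h, (not_le.1 h).le]

end RAM.Expr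

namespace RAM.State

@[simp] theorem reg_setReg (s : State) (r r' : ℕ) (z : ℤ) :
    (s.setReg r z).reg r' = if r' = r then z else s.reg r' := by
  simp [setReg, Function.update_apply]

@[simp] theorem mem_setReg (s : State) (r : ℕ) (z : ℤ) : (s.setReg r z).mem = s.mem := rfl

@[simp] theorem reg_setMem (s : State) (a : ℕ) (k z : ℤ) : (s.setMem a k z).reg = s.reg := rfl

@[simp] theorem mem_setMem (s : State) (a a' : ℕ) (k k' z : ℤ) :
    (s.setMem a k z).mem a' k' = if a' = a ∧ k' = k then z else s.mem a' k' := by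
  by_cases h : a' = a
  · subst h; simp [setMem, Function.update_apply]
  · simp [setMem, h]

end RAM.State

namespace KnapExp.PrefixProgram

open RAM RAM.Expr

/-! ### Quantities computed from the input memory

The program tries all triples `(w, s, j)`: `w` and `s` select a density, namely `p s / w s`, `0` or
`U s / w s`, and `j` selects the set of items whose gain comes before the gain of `j`. -/

section Values

variable (m : ℤ → ℤ) (w s j i : ℤ)

/-- Numerator of the selected value (`p s`, `0`, or `U s`). -/
def vNum : ℤ := (w - 1) * (w - 1) * m (8 * s + (5 + 2 * w))

/-- Denominator of the selected value. -/
def vDen : ℤ := m (8 * s + (6 + 2 * w))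

/-- Common denominator of the numbers of item `i`. -/
def den : ℤ := m (8 * i + 6) * m (8 * i + 10)

/-- Numerator of the excess of item `i` if it is not queried. -/
def exU : ℤ :=
  max 0 (m (8 * s + 4) * vDen m w s * m (8 * i + 9) - vNum m w s * m (8 * i + 4) * m (8 * i + 10))
    * m (8 * i + 6)

/-- Numerator of the excess of item `i` if it is queried. -/
def exP : ℤ :=
  max 0 (m (8 * s + 4) * vDen m w s * m (8 * i + 5) - vNum m w s * m (8 * i + 4) * m (8 * i + 6))
    * m (8 * i + 10)

/-- Numerator of the gain of querying item `i`. -/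
def gain : ℤ := exU m w s i - exP m w s i

/-- Incidence of item `i` in the set selected by `(w, s, j)`. -/
def inc : ℤ :=
  (if gain m w s j * den m i + 1 ≤ gain m w s i * den m j then 1 else 0) +
    (if gain m w s i * den m j ≤ gain m w s j * den m i then 1 else 0) *
      (if gain m w s j * den m i ≤ gain m w s i * den m j then 1 else 0) *
      (if i + 1 ≤ j then 1 else 0)

/-- Numerator of the excess of item `i` when the selected set is queried. -/
def term : ℤ := exU m w s i + inc m w s j i * (exP m w s i - exU m w s i)

/-- The machine only has `≤`: strictness between integers is `+ 1`, equality is a product of two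
comparisons. The two alternatives exclude each other, so their sum is again 0 or 1. -/
theorem inc_eq : inc m w s j i =
    if gain m w s j * den m i < gain m w s i * den m j ∨
      (gain m w s i * den m j = gain m w s j * den m i ∧ i < j) then 1 else 0 := by
  simp only [inc, Int.add_one_le_iff]
  rcases lt_trichotomy (gain m w s j * den m i) (gain m w s i * den m j) with h | h | h
  · simp [h, h.not_ge]
  · simp [h]
  · simp [h.not_ge, h.not_gt, h.ne]

theorem inc_eq_zero_or_one : inc m w s j i = 0 ∨ inc m w s j i = 1 := by
  rw [inc_eq]; split_ifs <;> simp

end Values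

/-! ### The program -/

def vNumE : Expr := (.reg 1 - 1) * (.reg 1 - 1) * .cell 0 (8 * .reg 2 + (5 + 2 * .reg 1))

def vDenE : Expr := .cell 0 (8 * .reg 2 + (6 + 2 * .reg 1))

def denE (x : Expr) : Expr := .cell 0 (8 * x + 6) * .cell 0 (8 * x + 10)

def exUE (x : Expr) : Expr :=
  pos (.cell 0 (8 * .reg 2 + 4) * vDenE * .cell 0 (8 * x + 9)
    - vNumE * .cell 0 (8 * x + 4) * .cell 0 (8 * x + 10)) * .cell 0 (8 * x + 6)

def exPE (x : Expr) : Expr :=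
  pos (.cell 0 (8 * .reg 2 + 4) * vDenE * .cell 0 (8 * x + 5)
    - vNumE * .cell 0 (8 * x + 4) * .cell 0 (8 * x + 6)) * .cell 0 (8 * x + 10)

def gainE (x : Expr) : Expr := exUE x - exPE x

def incE : Expr :=
  .le (gainE (.reg 3) * denE (.reg 4) + 1) (gainE (.reg 4) * denE (.reg 3)) +
    .le (gainE (.reg 4) * denE (.reg 3)) (gainE (.reg 3) * denE (.reg 4)) *
      .le (gainE (.reg 3) * denE (.reg 4)) (gainE (.reg 4) * denE (.reg 3)) *
      .le (.reg 4 + 1) (.reg 3)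

def termE : Expr := exUE (.reg 4) + incE * (exPE (.reg 4) - exUE (.reg 4))

section Eval

variable (σ : State) (x : Expr)

theorem eval_vNumE : vNumE.eval σ = vNum (σ.mem 0) (σ.reg 1) (σ.reg 2) := by
  simp [vNumE, vNum]

theorem eval_vDenE : vDenE.eval σ = vDen (σ.mem 0) (σ.reg 1) (σ.reg 2) := by
  simp [vDenE, vDen]

theorem eval_denE : (denE x).eval σ = den (σ.mem 0) (x.eval σ) := by simp [denE, den]

theorem eval_exUE : (exUE x).eval σ = exU (σ.mem 0) (σ.reg 1) (σ.reg 2) (x.eval σ) := by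
  simp [exUE, exU, eval_vNumE, eval_vDenE]

theorem eval_exPE : (exPE x).eval σ = exP (σ.mem 0) (σ.reg 1) (σ.reg 2) (x.eval σ) := by
  simp [exPE, exP, eval_vNumE, eval_vDenE]

theorem eval_gainE : (gainE x).eval σ = gain (σ.mem 0) (σ.reg 1) (σ.reg 2) (x.eval σ) := by
  simp [gainE, gain, eval_exUE, eval_exPE]

theorem eval_incE :
    incE.eval σ = inc (σ.mem 0) (σ.reg 1) (σ.reg 2) (σ.reg 3) (σ.reg 4) := by
  simp [incE, inc, eval_gainE, eval_denE]

theorem eval_termE :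
    termE.eval σ = term (σ.mem 0) (σ.reg 1) (σ.reg 2) (σ.reg 3) (σ.reg 4) := by
  simp [termE, term, eval_exUE, eval_exPE, eval_incE]

end Eval

def lessE (x y : Expr) : Expr := .le (x + 1) y

theorem eval_lessE_ne_zero (σ : State) (x y : Expr) :
    (lessE x y).eval σ ≠ 0 ↔ x.eval σ < y.eval σ := by
  simp [lessE]

/-- The condition that certifies the quality of the selected set. -/
def passE : Expr :=
  .le (vNumE * (.cell 0 1 - .cell 0 (8 * .reg 2 + 4)) * .reg 6 * .cell 0 3 + .reg 5 * .cell 0 3)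
    (.cell 0 2 * (.cell 0 (8 * .reg 2 + 4) * vDenE) * .reg 6)

/-- Process item `i` (register 4): write its incidence, and update the total excess (registers 5
and 6, as a fraction) and the cardinality (register 7) of the selected set. -/
def itemStep : Prog :=
  .seq (.store 1 (.reg 4) incE) <|
  .seq (.assign 7 (.reg 7 + incE)) <|
  .seq (.assign 5 (.reg 5 * denE (.reg 4) + termE * .reg 6)) <|
  .seq (.assign 6 (.reg 6 * denE (.reg 4))) <|
  .assign 4 (.reg 4 + 1)

/-- Evaluate the set selected by registers 1, 2, 3, and write it to memory 1. -/
def evalSet : Prog :=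
  .seq (.assign 4 0) <| .seq (.assign 5 0) <| .seq (.assign 6 1) <| .seq (.assign 7 0) <|
  .while (lessE (.reg 4) (.reg 0)) itemStep

/-- Remember the selection in registers 8 to 11 if it is an improvement. -/
def update : Prog :=
  .ite (passE * lessE (.reg 7) (.reg 11))
    (.seq (.assign 8 (.reg 1)) <| .seq (.assign 9 (.reg 2)) <| .seq (.assign 10 (.reg 3)) <|
      .assign 11 (.reg 7))
    .skip

def loopJ : Prog :=
  .seq (.assign 3 0) <|
  .while (lessE (.reg 3) (.reg 0)) <| .seq (.seq evalSet update) <| .assign 3 (.reg 3 + 1)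

def loopS : Prog :=
  .seq (.assign 2 0) <|
  .while (lessE (.reg 2) (.reg 0)) <| .seq loopJ <| .assign 2 (.reg 2 + 1)

def loopW : Prog :=
  .seq (.assign 1 0) <|
  .while (lessE (.reg 1) 3) <| .seq loopS <| .assign 1 (.reg 1 + 1)

/-- Register 0 initially holds the length of the input list and is replaced by `n`, which is also
the output length. Registers 8 to 11 start as `0, 0, n, n`, which encodes the full set
(`sel_default`). The last `evalSet` is needed because later trials overwrite the best set in memory
1. -/
def main : Prog :=
  .seq (.assign 0 (.cell 0 0)) <| .seq (.assign 10 (.reg 0)) <| .seq (.assign 11 (.reg 0)) <|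
  .seq loopW <|
  .seq (.assign 1 (.reg 8)) <| .seq (.assign 2 (.reg 9)) <| .seq (.assign 3 (.reg 10)) <|
  evalSet

/-! ### Size bounds -/

/-- Assumptions on the input memory `m` of an instance with `n` items and size `S`. -/
structure Input (m : ℤ → ℤ) (n S : ℕ) : Prop where
  bits_le : ∀ k, bits (m k) ≤ S
  n_le : n + 4 ≤ S
  den_pos : ∀ i : ℕ, i < n → 0 < den m i

/-- Bound for the bit growth of the accumulated fraction in one step. -/
def growth (S : ℕ) : ℕ := (termE.factor + (denE (.reg 4)).factor) * S + 1

/-- Bound for the bits of all numbers that occur. -/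
def bitBound (S : ℕ) : ℕ := growth S * S + 2 + S

/-- Properties that hold throughout the run. -/
structure Sane (m : ℤ → ℤ) (n S : ℕ) (σ : State) : Prop where
  mem_zero : σ.mem 0 = m
  mem_one : ∀ k, σ.mem 1 k = 0 ∨ σ.mem 1 k = 1
  mem_ge : ∀ a, 2 ≤ a → ∀ k, σ.mem a k = 0
  reg_zero : σ.reg 0 = n
  reg_small : ∀ r, r ≠ 5 → r ≠ 6 → 0 ≤ σ.reg r ∧ σ.reg r ≤ (n + 3 : ℕ)
  reg_five : bits (σ.reg 5) ≤ bitBound S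
  reg_six : bits (σ.reg 6) ≤ bitBound S

variable {m : ℤ → ℤ} {n S : ℕ}

theorem Sane.bdd (hI : Input m n S) {σ : State} (h : Sane m n S σ) : Bdd (bitBound S) σ := by
  have hS : S ≤ bitBound S := Nat.le_add_left _ _
  have hn := hI.n_le
  refine ⟨fun r => ?_, fun a k => ?_⟩
  · by_cases h5 : r = 5
    · exact h5 ▸ h.reg_five
    by_cases h6 : r = 6
    · exact h6 ▸ h.reg_six
    obtain ⟨h0, h1⟩ := h.reg_small r h5 h6
    have := bits_le_of_nonneg_of_le h0 h1
    omega
  · match a with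
    | 0 => exact h.mem_zero ▸ (hI.bits_le k).trans hS
    | 1 => rcases h.mem_one k with h | h <;> rw [h] <;> simp [bits] <;> omega
    | a + 2 => rw [h.mem_ge _ (by omega) k]; simp [bits]; omega

theorem Sane.setReg {σ : State} (h : Sane m n S σ) {r : ℕ} {z : ℤ} (hr0 : r ≠ 0) (hr5 : r ≠ 5)
    (hr6 : r ≠ 6) (h0 : 0 ≤ z) (hz : z ≤ (n + 3 : ℕ)) : Sane m n S (σ.setReg r z) where
  mem_zero := h.mem_zero
  mem_one := h.mem_one
  mem_ge := h.mem_ge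
  reg_zero := by simp [hr0.symm, h.reg_zero]
  reg_small r' h5 h6 := by
    rw [State.reg_setReg]
    split_ifs
    exacts [⟨h0, hz⟩, h.reg_small r' h5 h6]
  reg_five := by simpa [hr5.symm] using h.reg_five
  reg_six := by simpa [hr6.symm] using h.reg_six

theorem Sane.setReg_five {σ : State} (h : Sane m n S σ) {z : ℤ} (hz : bits z ≤ bitBound S) :
    Sane m n S (σ.setReg 5 z) where
  mem_zero := h.mem_zero
  mem_one := h.mem_one
  mem_ge := h.mem_ge
  reg_zero := by simp [h.reg_zero]
  reg_small r' h5 h6 := by simpa [h5] using h.reg_small r' h5 h6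
  reg_five := by simpa using hz
  reg_six := by simpa using h.reg_six

theorem Sane.setReg_six {σ : State} (h : Sane m n S σ) {z : ℤ} (hz : bits z ≤ bitBound S) :
    Sane m n S (σ.setReg 6 z) where
  mem_zero := h.mem_zero
  mem_one := h.mem_one
  mem_ge := h.mem_ge
  reg_zero := by simp [h.reg_zero]
  reg_small r' h5 h6 := by simpa [h6] using h.reg_small r' h5 h6
  reg_five := by simpa using h.reg_five
  reg_six := by simpa using hz

theorem Sane.setMem {σ : State} (h : Sane m n S σ) {k z : ℤ} (hz : z = 0 ∨ z = 1) :
    Sane m n S (σ.setMem 1 k z) where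
  mem_zero := by
    funext k'
    simp [h.mem_zero]
  mem_one k' := by
    rw [State.mem_setMem]
    split_ifs
    exacts [hz, h.mem_one k']
  mem_ge a ha k' := by
    rw [State.mem_setMem, if_neg (by omega), h.mem_ge a ha]
  reg_zero := h.reg_zero
  reg_small := h.reg_small
  reg_five := h.reg_five
  reg_six := h.reg_six

/-- Neither expression reads the accumulators in registers 5 and 6. Evaluating them in an auxiliary
state without large registers gives a bound in terms of `S` instead of `bitBound S`, so the growth
does not compound. -/
theorem abs_term_lt_and_abs_den_lt (hI : Input m n S) {w s j i : ℤ}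
    (hw : 0 ≤ w ∧ w ≤ (n + 3 : ℕ)) (hs : 0 ≤ s ∧ s ≤ (n + 3 : ℕ)) (hj : 0 ≤ j ∧ j ≤ (n + 3 : ℕ))
    (hi : 0 ≤ i ∧ i ≤ (n + 3 : ℕ)) :
    |term m w s j i| < 2 ^ (growth S - 1) ∧ |den m i| < 2 ^ (growth S - 1) := by
  let σ : State := ⟨fun r => if r = 1 then w else if r = 2 then s else if r = 3 then j else
    if r = 4 then i else 0, fun a => if a = 0 then m else fun _ => 0⟩
  have hn := hI.n_le
  have hσ : Bdd S σ := by
    constructor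
    · intro r
      have : 0 ≤ σ.reg r ∧ σ.reg r ≤ (n + 3 : ℕ) := by
        dsimp only [σ]
        split_ifs
        exacts [hw, hs, hj, hi, ⟨le_rfl, by positivity⟩]
      exact (bits_le_of_nonneg_of_le this.1 this.2).trans (by omega)
    · intro a k
      by_cases ha : a = 0
      · simpa [σ, ha] using hI.bits_le k
      · simp [σ, ha, bits]; omega
  have h1 := termE.bits_eval_le hσ
  have h2 := (denE (.reg 4)).bits_eval_le hσ
  have e : growth S - 1 = termE.factor * S + (denE (.reg 4)).factor * S := by
    rw [growth, Nat.add_sub_cancel, add_mul]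
  rw [eval_termE] at h1
  rw [eval_denE] at h2
  exact ⟨abs_lt_of_bits_le (h1.trans (by omega)), abs_lt_of_bits_le (h2.trans (by omega))⟩

theorem bits_le_bitBound {z : ℤ} {k : ℕ} (hk : k ≤ S) (hz : |z| ≤ 2 ^ (growth S * k)) :
    bits z ≤ bitBound S := by
  have h : bits z ≤ growth S * k + 1 + 1 := by
    rw [bits_le_succ_iff, pow_succ]
    have : (0 : ℤ) < 2 ^ (growth S * k) := by positivity
    linarith
  have := Nat.mul_le_mul_left (growth S) hk
  rw [bitBound]
  omega

/-- One bit of `growth S` is reserved for the addition of the two products; the remaining `growth S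
- 1` bits pay for the multiplications. -/
theorem abs_accumulate_le {x y d t : ℤ} {k : ℕ} (hx : |x| ≤ 2 ^ (growth S * k))
    (hy : |y| ≤ 2 ^ (growth S * k)) (hd : |d| < 2 ^ (growth S - 1))
    (ht : |t| < 2 ^ (growth S - 1)) :
    |x * d + t * y| ≤ 2 ^ (growth S * (k + 1)) ∧ |y * d| ≤ 2 ^ (growth S * (k + 1)) := by
  have e : (2 : ℤ) ^ (growth S * (k + 1))
      = 2 * (2 ^ (growth S * k) * 2 ^ (growth S - 1)) := by
    rw [← pow_add, ← pow_succ']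
    have : 1 ≤ growth S := Nat.le_add_left _ _
    rw [mul_add, mul_one, add_assoc, Nat.sub_add_cancel this]
  have h1 : |x * d| ≤ 2 ^ (growth S * k) * 2 ^ (growth S - 1) := by
    rw [abs_mul]; exact mul_le_mul hx hd.le (abs_nonneg _) (by positivity)
  have h2 : |t * y| ≤ 2 ^ (growth S * k) * 2 ^ (growth S - 1) := by
    rw [abs_mul, mul_comm]; exact mul_le_mul hy ht.le (abs_nonneg _) (by positivity)
  have h3 : |y * d| ≤ 2 ^ (growth S * k) * 2 ^ (growth S - 1) := by
    rw [abs_mul]; exact mul_le_mul hy hd.le (abs_nonneg _) (by positivity)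
  have := abs_add_le (x * d) (t * y)
  have : (0 : ℤ) < 2 ^ (growth S * k) * 2 ^ (growth S - 1) := by positivity
  constructor <;> linarith

/-! ### Correctness of the evaluation of a set -/

/-- The number of items below `k` in the set selected by `(w, s, j)`. -/
def count (m : ℤ → ℤ) (w s j : ℤ) (k : ℕ) : ℤ := ∑ i ∈ Finset.range k, inc m w s j i

/-- The total excess of the items below `k` when the set selected by `(w, s, j)` is queried. -/
def total (m : ℤ → ℤ) (w s j : ℤ) (k : ℕ) : ℚ :=
  ∑ i ∈ Finset.range k, (term m w s j i : ℚ) / den m i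

theorem count_nonneg (w s j : ℤ) (k : ℕ) : 0 ≤ count m w s j k :=
  Finset.sum_nonneg fun i _ => by
    rcases inc_eq_zero_or_one m w s j i with h | h <;> simp [h]

theorem count_le (w s j : ℤ) (k : ℕ) : count m w s j k ≤ k := by
  have : count m w s j k ≤ ∑ i ∈ Finset.range k, (1 : ℤ) := Finset.sum_le_sum fun i _ => by
    rcases inc_eq_zero_or_one m w s j i with h | h <;> simp [h]
  simpa using this

/-- Invariant of `evalSet` after `k` items, started in `σ₀`. -/
structure EvalInv (m : ℤ → ℤ) (n S : ℕ) (σ₀ : State) (k : ℕ) (σ : State) : Prop where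
  sane : Sane m n S σ
  frame : ∀ r, r ≠ 4 → r ≠ 5 → r ≠ 6 → r ≠ 7 → σ.reg r = σ₀.reg r
  index : σ.reg 4 = k
  abs_num : |σ.reg 5| ≤ 2 ^ (growth S * k)
  abs_den : |σ.reg 6| ≤ 2 ^ (growth S * k)
  den_pos : 0 < σ.reg 6
  total_eq : (σ.reg 5 : ℚ) = σ.reg 6 * total m (σ₀.reg 1) (σ₀.reg 2) (σ₀.reg 3) k
  count_eq : σ.reg 7 = count m (σ₀.reg 1) (σ₀.reg 2) (σ₀.reg 3) k
  output : ∀ i : ℕ, i < k → σ.mem 1 i = inc m (σ₀.reg 1) (σ₀.reg 2) (σ₀.reg 3) i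

theorem runs_itemStep (hI : Input m n S) {σ₀ σ : State} {k : ℕ} (hk : k < n)
    (h : EvalInv m n S σ₀ k σ) :
    Runs (bitBound S) S itemStep σ (EvalInv m n S σ₀ (k + 1)) := by
  have hn := hI.n_le
  have h1 := h.frame 1 (by decide) (by decide) (by decide) (by decide)
  have h2 := h.frame 2 (by decide) (by decide) (by decide) (by decide)
  have h3 := h.frame 3 (by decide) (by decide) (by decide) (by decide)
  have h4 := h.index
  have h7 := h.count_eq
  have hm := h.sane.mem_zero
  obtain ⟨ht, hd⟩ := abs_term_lt_and_abs_den_lt hI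
    (h1 ▸ h.sane.reg_small 1 (by decide) (by decide))
    (h2 ▸ h.sane.reg_small 2 (by decide) (by decide))
    (h3 ▸ h.sane.reg_small 3 (by decide) (by decide))
    (h4 ▸ h.sane.reg_small 4 (by decide) (by decide))
  obtain ⟨a5, a6⟩ := abs_accumulate_le h.abs_num h.abs_den hd ht
  set w := σ₀.reg 1
  set s := σ₀.reg 2
  set j := σ₀.reg 3
  have hinc : inc m w s j k = 0 ∨ inc m w s j k = 1 := inc_eq_zero_or_one m w s j k
  have hcount : count m w s j (k + 1) = count m w s j k + inc m w s j k :=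
    Finset.sum_range_succ _ _
  have htotal : total m w s j (k + 1) = total m w s j k + (term m w s j k : ℚ) / den m k :=
    Finset.sum_range_succ _ _
  have hdk := hI.den_pos k hk
  have hc0 := count_nonneg (m := m) w s j (k + 1)
  have hck := count_le (m := m) w s j (k + 1)
  have s1 : Sane m n S (σ.setMem 1 k (inc m w s j k)) := h.sane.setMem hinc
  have s2 := s1.setReg (r := 7) (by decide) (by decide) (by decide) hc0 (by omega)
  have s3 := s2.setReg_five (bits_le_bitBound (k := k + 1) (by omega) a5)
  have s4 := s3.setReg_six (bits_le_bitBound (k := k + 1) (by omega) a6)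
  have s5 := s4.setReg (r := 4) (z := k + 1) (by decide) (by decide) (by decide) (by omega)
    (by push_cast; omega)
  have e0 : (Expr.reg 4).eval σ = k := h4
  have e1 : incE.eval σ = inc m w s j k := by rw [eval_incE, h1, h2, h3, h4, hm]
  refine Runs.seq (Runs.store (h.sane.bdd hI) ?_)
  rw [e0, e1]
  have e2 : (Expr.reg 7 + incE).eval (σ.setMem 1 k (inc m w s j k)) = count m w s j (k + 1) := by
    rw [eval_add, eval_incE, s1.mem_zero, hcount]
    simp [h1, h2, h3, h4, h7]
  refine Runs.seq (Runs.assign (s1.bdd hI) ?_)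
  rw [e2]
  refine Runs.seq (Runs.assign (s2.bdd hI) ?_)
  -- Register 6 still holds the old denominator here, as the addition of fractions requires.
  have e3 : (Expr.reg 5 * denE (.reg 4) + termE * .reg 6).eval
      ((σ.setMem 1 k (inc m w s j k)).setReg 7 (count m w s j (k + 1)))
      = σ.reg 5 * den m k + term m w s j k * σ.reg 6 := by
    rw [eval_add, eval_mul, eval_mul, eval_termE, eval_denE, s2.mem_zero]
    simp [h1, h2, h3, h4]
  rw [e3]
  refine Runs.seq (Runs.assign (s3.bdd hI) ?_)
  have e4 : (Expr.reg 6 * denE (.reg 4)).eval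
      (((σ.setMem 1 k (inc m w s j k)).setReg 7 (count m w s j (k + 1))).setReg 5
        (σ.reg 5 * den m k + term m w s j k * σ.reg 6)) = σ.reg 6 * den m k := by
    rw [eval_mul, eval_denE, s3.mem_zero]
    simp [h4]
  rw [e4]
  refine Runs.assign (s4.bdd hI) ?_
  have e5 : ∀ τ : State, τ.reg 4 = k → (Expr.reg 4 + 1).eval τ = k + 1 := by
    intro τ hτ; simp [hτ]
  rw [e5 _ (by simp [h4])]
  refine ⟨s5, ?_, by simp, by simpa using a5, by simpa using a6, ?_, ?_, by simp [w, s, j], ?_⟩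
  · intro r hr4 hr5 hr6 hr7
    simpa [hr4, hr5, hr6, hr7] using h.frame r hr4 hr5 hr6 hr7
  · simpa using mul_pos h.den_pos hdk
  · have hd0 : (den m k : ℚ) ≠ 0 := by exact_mod_cast hdk.ne'
    have ht := h.total_eq
    change ((_ : ℤ) : ℚ) = _ * total m w s j (k + 1)
    change (σ.reg 5 : ℚ) = σ.reg 6 * total m w s j k at ht
    rw [htotal]
    simp
    rw [ht]
    field_simp
  · intro i hi
    rcases Nat.lt_succ_iff_lt_or_eq.1 hi with hi | rfl
    · have hne : (i : ℤ) ≠ k := by omega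
      simpa [hne] using h.output i hi
    · simp [w, s, j]

theorem runs_evalSet (hI : Input m n S) {σ : State} (h : Sane m n S σ) :
    Runs (bitBound S) S evalSet σ (EvalInv m n S σ n) := by
  have hn := hI.n_le
  have hb := h.bdd hI
  have hone : (1 : ℕ) ≤ bitBound S := hb.one_le
  have s1 := h.setReg (r := 4) (z := 0) (by decide) (by decide) (by decide) le_rfl (by positivity)
  have s2 := s1.setReg_five (z := 0) (by simpa [bits] using hone)
  have s3 := s2.setReg_six (z := 1) (by simp [bits, bitBound]; omega)
  have s4 := s3.setReg (r := 7) (z := 0) (by decide) (by decide) (by decide) le_rfl (by positivity)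
  refine Runs.seq (Runs.assign hb ?_)
  refine Runs.seq (Runs.assign (s1.bdd hI) ?_)
  refine Runs.seq (Runs.assign (s2.bdd hI) ?_)
  refine Runs.seq (Runs.assign (s3.bdd hI) ?_)
  refine Runs.loop (by omega) (fun k hk τ hτ => ⟨hτ.sane.bdd hI, ?_⟩)
    (fun k hk τ hτ => runs_itemStep hI hk hτ) ⟨s4, ?_, ?_, ?_, ?_, ?_, ?_, ?_, ?_⟩
  · rw [eval_lessE_ne_zero]
    simp [hτ.index, hτ.sane.reg_zero]
  · intro r hr4 hr5 hr6 hr7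
    simp [hr4, hr5, hr6, hr7]
  all_goals simp [total, count]

/-! ### The input memory of an instance -/

theorem getD_flatMap {α : Type*} {f : α → List ℤ} {c : ℕ} (hf : ∀ a, (f a).length = c) :
    ∀ (l : List α) (i : ℕ) (hi : i < l.length) (k : ℕ), k < c →
      (l.flatMap f).getD (c * i + k) 0 = (f l[i]).getD k 0
  | [], i, hi, _, _ => by simp at hi
  | a :: l, 0, _, k, hk => by
    rw [List.flatMap_cons, List.getD_append _ _ _ _ (by rw [hf]; omega)]
    simp
  | a :: l, i + 1, hi, k, hk => by
    have e : c * (i + 1) + k = c + (c * i + k) := by ring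
    rw [List.flatMap_cons, List.getD_append_right _ _ _ _ (by rw [hf]; omega), hf, e,
      Nat.add_sub_cancel_left, getD_flatMap hf l i (by simpa using hi) k hk]
    simp

variable (K : PrefixInstance)

/-- The input memory. -/
def inputMem : ℤ → ℤ := (load K.encode).mem 0

theorem inputMem_natCast (k : ℕ) : inputMem K k = K.encode.getD k 0 := by
  simp [inputMem, load]

theorem length_encode : K.encode.length = 8 * K.n + 4 := by
  simp [PrefixInstance.encode, List.length_flatMap]
  ring

theorem inputMem_of_le {k : ℕ} (hk : 8 * K.n + 4 ≤ k) : inputMem K k = 0 := by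
  rw [inputMem_natCast, List.getD_eq_default]
  rwa [length_encode]

theorem inputMem_header : inputMem K 0 = K.n ∧ inputMem K 1 = K.B ∧ inputMem K 2 = K.D.num ∧
    inputMem K 3 = K.D.den :=
  ⟨inputMem_natCast K 0, inputMem_natCast K 1, inputMem_natCast K 2, inputMem_natCast K 3⟩

/-- Four header cells are followed by blocks of eight, so item `i` occupies the cells `8 * i + 4` to
`8 * i + 11`. -/
theorem inputMem_item (i : Fin K.n) (k : ℕ) (hk : k < 8) :
    inputMem K (8 * (i : ℕ) + (4 + k : ℕ)) =
      [(K.w i : ℤ), (K.p i).num, ((K.p i).den : ℤ), (K.L i).num, ((K.L i).den : ℤ),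
        (K.U i).num, ((K.U i).den : ℤ), ((K.rank i : ℕ) : ℤ)].getD k 0 := by
  have e : (8 * (i : ℕ) + (4 + k : ℕ) : ℤ) = ((4 + (8 * i + k) : ℕ) : ℤ) := by push_cast; ring
  rw [e, inputMem_natCast, PrefixInstance.encode, List.getD_append_right _ _ _ _ (by simp)]
  have h4 : 4 + (8 * (i : ℕ) + k) - [(K.n : ℤ), (K.B : ℤ), K.D.num, (K.D.den : ℤ)].length
      = 8 * i + k := by simp
  rw [h4, getD_flatMap (c := 8) (fun _ => rfl) _ _ (by simp) _ hk]
  simp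

section Items

variable (i : Fin K.n)

theorem inputMem_w : inputMem K (8 * (i : ℕ) + 4) = K.w i := inputMem_item K i 0 (by decide)
theorem inputMem_p_num : inputMem K (8 * (i : ℕ) + 5) = (K.p i).num :=
  inputMem_item K i 1 (by decide)
theorem inputMem_p_den : inputMem K (8 * (i : ℕ) + 6) = (K.p i).den :=
  inputMem_item K i 2 (by decide)
theorem inputMem_L_den : inputMem K (8 * (i : ℕ) + 8) = (K.L i).den :=
  inputMem_item K i 4 (by decide)
theorem inputMem_U_num : inputMem K (8 * (i : ℕ) + 9) = (K.U i).num :=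
  inputMem_item K i 5 (by decide)
theorem inputMem_U_den : inputMem K (8 * (i : ℕ) + 10) = (K.U i).den :=
  inputMem_item K i 6 (by decide)

theorem den_pos : 0 < den (inputMem K) (i : ℕ) := by
  rw [den, inputMem_p_den, inputMem_U_den]
  exact_mod_cast Nat.mul_pos (K.p i).den_pos (K.U i).den_pos

end Items

theorem bits_le_inputSize {l : List ℤ} {z : ℤ} (h : z ∈ l) : bits z ≤ inputSize l :=
  List.single_le_sum (fun _ _ => Nat.zero_le _) _ (List.mem_map_of_mem h)

theorem length_le_inputSize (l : List ℤ) : l.length ≤ inputSize l := by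
  have := List.length_le_sum_of_one_le (l.map bits) fun k hk => by
    obtain ⟨z, -, rfl⟩ := List.mem_map.1 hk
    exact one_le_bits z
  simpa [inputSize] using this

theorem input_inputMem : Input (inputMem K) K.n (inputSize K.encode) where
  bits_le k := by
    have h1 : 1 ≤ inputSize K.encode :=
      le_trans (by rw [length_encode]; omega) (length_le_inputSize K.encode)
    simp only [inputMem, load, true_and]
    split_ifs
    · by_cases hk : k.toNat < K.encode.length
      · rw [List.getD_eq_getElem _ _ hk]
        exact bits_le_inputSize (List.getElem_mem hk)
      · rw [List.getD_eq_default _ _ (not_lt.1 hk)]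
        exact h1
    · exact h1
  n_le := le_trans (by rw [length_encode]; omega) (length_le_inputSize K.encode)
  den_pos i hi := den_pos K ⟨i, hi⟩

/-! ### Meaning of the computed quantities -/

/-- The selected set. -/
def sel (w s j : ℤ) : Finset (Fin K.n) :=
  Finset.univ.filter fun i => inc (inputMem K) w s j (i : ℕ) = 1

/-- The scaling factor of excesses. -/
def scale (w s : ℤ) : ℚ := inputMem K (8 * s + 4) * vDen (inputMem K) w s

/-- The certificate for the quality of the selected set. -/
def Pass (w s j : ℤ) : Prop :=
  (vNum (inputMem K) w s : ℚ) * (K.B - inputMem K (8 * s + 4)) + total (inputMem K) w s j K.n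
    ≤ K.D * scale K w s

theorem count_eq_card (w s j : ℤ) : count (inputMem K) w s j K.n = (sel K w s j).card := by
  rw [count, Finset.sum_range, sel, Finset.card_filter]
  push_cast
  refine Finset.sum_congr rfl fun i _ => ?_
  rcases inc_eq_zero_or_one (inputMem K) w s j (i : ℕ) with h | h <;> simp [h]

/-- Taking positive parts commutes with the positive factor `c` that clears the denominator; `d`
extends the fraction to the common denominator of the item. -/
theorem max_zero_mul_div {a b c d : ℚ} (hc : 0 < c) (hd : 0 < d) (h : a = b * c) :
    max 0 a * d / (d * c) = max 0 b := by
  rw [h, mul_comm d c, mul_div_mul_right _ _ hd.ne', ← zero_mul c,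
    ← max_mul_of_nonneg _ _ hc.le, mul_div_cancel_right₀ _ hc.ne', zero_mul]

theorem exU_div_den (w s : ℤ) (i : Fin K.n) :
    (exU (inputMem K) w s (i : ℕ) : ℚ) / den (inputMem K) (i : ℕ)
      = K.excess (scale K w s) (vNum (inputMem K) w s) ∅ i := by
  rw [exU, den, inputMem_p_den, inputMem_U_den, inputMem_U_num, inputMem_w,
    PrefixInstance.excess, Instance.upper, if_neg (Finset.notMem_empty i)]
  push_cast
  refine max_zero_mul_div (by exact_mod_cast (K.U i).den_pos)
    (by exact_mod_cast (K.p i).den_pos) ?_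
  rw [scale, sub_mul, mul_assoc _ (K.U i), Rat.mul_den_eq_num]

theorem exP_div_den (w s : ℤ) (i : Fin K.n) :
    (exP (inputMem K) w s (i : ℕ) : ℚ) / den (inputMem K) (i : ℕ)
      = K.excess (scale K w s) (vNum (inputMem K) w s) Finset.univ i := by
  rw [exP, den, inputMem_p_den, inputMem_U_den, inputMem_p_num, inputMem_w,
    PrefixInstance.excess, Instance.upper, if_pos (Finset.mem_univ i)]
  push_cast
  rw [mul_comm ((K.p i).den : ℚ)]
  refine max_zero_mul_div (by exact_mod_cast (K.p i).den_pos)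
    (by exact_mod_cast (K.U i).den_pos) ?_
  rw [scale, sub_mul, mul_assoc _ (K.p i), Rat.mul_den_eq_num]

/-- The excess of an item depends only on whether that item is queried; `∅` and `Finset.univ` serve
as the two reference cases. -/
theorem excess_eq_ite (c N : ℚ) (Q : Finset (Fin K.n)) (i : Fin K.n) :
    K.excess c N Q i = if i ∈ Q then K.excess c N Finset.univ i else K.excess c N ∅ i := by
  by_cases h : i ∈ Q <;> simp [PrefixInstance.excess, Instance.upper, h]

theorem total_eq (w s j : ℤ) : total (inputMem K) w s j K.n
    = ∑ i, K.excess (scale K w s) (vNum (inputMem K) w s) (sel K w s j) i := by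
  rw [total, Finset.sum_range]
  refine Finset.sum_congr rfl fun i _ => ?_
  rw [excess_eq_ite, ← exU_div_den, ← exP_div_den, term]
  rcases inc_eq_zero_or_one (inputMem K) w s j (i : ℕ) with h | h <;> simp [sel, h]

section Selected

variable (s : Fin K.n)

theorem vNum_zero : vNum (inputMem K) 0 (s : ℕ) = (K.p s).num := by
  simpa [vNum] using inputMem_p_num K s

theorem vDen_zero : vDen (inputMem K) 0 (s : ℕ) = (K.p s).den := by
  simpa [vDen] using inputMem_p_den K s

/-- For `w = 1` the address points at the numerator of `L s`, which the factor `(w - 1) * (w - 1)`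
erases; it is 1 in the other two cases. -/
theorem vNum_one (s : ℤ) : vNum (inputMem K) 1 s = 0 := by simp [vNum]

/-- The value 0 borrows the denominator of `L s`; only its positivity matters. -/
theorem vDen_one : vDen (inputMem K) 1 (s : ℕ) = (K.L s).den := by
  simpa [vDen] using inputMem_L_den K s

theorem vNum_two : vNum (inputMem K) 2 (s : ℕ) = (K.U s).num := by
  simpa [vNum] using inputMem_U_num K s

theorem vDen_two : vDen (inputMem K) 2 (s : ℕ) = (K.U s).den := by
  simpa [vDen] using inputMem_U_den K s

variable {s}

theorem vDen_pos {w : ℕ} (hw : w < 3) : 0 < vDen (inputMem K) w (s : ℕ) := by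
  interval_cases w
  · rw [Nat.cast_zero, vDen_zero]; exact_mod_cast (K.p s).den_pos
  · rw [Nat.cast_one, vDen_one]; exact_mod_cast (K.L s).den_pos
  · rw [Nat.cast_ofNat, vDen_two]; exact_mod_cast (K.U s).den_pos

theorem vNum_nonneg {w : ℕ} (hw : w < 3) : 0 ≤ vNum (inputMem K) w (s : ℕ) := by
  interval_cases w
  · rw [Nat.cast_zero, vNum_zero]; exact Rat.num_nonneg.2 (K.p_nonneg s)
  · rw [Nat.cast_one, vNum_one]
  · rw [Nat.cast_ofNat, vNum_two]
    exact Rat.num_nonneg.2 ((K.p_nonneg s).trans (K.p_le_U s))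

theorem vNum_le {w : ℕ} (hw : w < 3) :
    (vNum (inputMem K) w (s : ℕ) : ℚ) ≤ K.U s * vDen (inputMem K) w (s : ℕ) := by
  interval_cases w
  · rw [Nat.cast_zero, vNum_zero, vDen_zero, Int.cast_natCast, ← Rat.mul_den_eq_num (K.p s)]
    exact mul_le_mul_of_nonneg_right (K.p_le_U s) (Nat.cast_nonneg _)
  · rw [Nat.cast_one, vNum_one, vDen_one, Int.cast_zero, Int.cast_natCast]
    exact mul_nonneg ((K.p_nonneg s).trans (K.p_le_U s)) (Nat.cast_nonneg _)
  · rw [Nat.cast_ofNat, vNum_two, vDen_two, Int.cast_natCast, Rat.mul_den_eq_num]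

theorem exists_vNum_eq {v : ℚ} (hv : v = K.p s ∨ v = 0 ∨ v = K.U s) :
    ∃ w : ℕ, w < 3 ∧ (vNum (inputMem K) w (s : ℕ) : ℚ) = v * vDen (inputMem K) w (s : ℕ) := by
  rcases hv with rfl | rfl | rfl
  · refine ⟨0, by decide, ?_⟩
    rw [Nat.cast_zero, vNum_zero, vDen_zero, Int.cast_natCast, Rat.mul_den_eq_num]
  · refine ⟨1, by decide, ?_⟩
    rw [Nat.cast_one, vNum_one, Int.cast_zero, zero_mul]
  · refine ⟨2, by decide, ?_⟩
    rw [Nat.cast_ofNat, vNum_two, vDen_two, Int.cast_natCast, Rat.mul_den_eq_num]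

end Selected

theorem scale_eq (w : ℕ) (s : Fin K.n) :
    scale K w (s : ℕ) = K.w s * vDen (inputMem K) w (s : ℕ) := by
  rw [scale, inputMem_w, Int.cast_natCast]

theorem scale_pos {w : ℕ} (hw : w < 3) (s : Fin K.n) : 0 < scale K w (s : ℕ) := by
  rw [scale_eq]
  exact mul_pos (by exact_mod_cast K.w_pos s) (by exact_mod_cast vDen_pos K (s := s) hw)

/-- Soundness of the test: the error term, density times `w s`, is the selected value, which is at
most `U s`. -/
theorem Pass.prefixValue_le {w s : ℕ} {j : ℤ} (hw : w < 3) (hs : s < K.n) (h : Pass K w s j) :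
    K.prefixValue (sel K w s j) ≤ K.D + 2 * K.maxUpper := by
  have h2 := vNum_nonneg K (s := ⟨s, hs⟩) hw
  have h3 := vNum_le K (s := ⟨s, hs⟩) hw
  rw [Pass, total_eq] at h
  refine K.prefixValue_le_of_excess_le (scale_pos K hw ⟨s, hs⟩) (by exact_mod_cast h2) ?_ h
  have hwt : (0 : ℚ) < K.w ⟨s, hs⟩ := by exact_mod_cast K.w_pos ⟨s, hs⟩
  have hD : (0 : ℚ) < vDen (inputMem K) w s := by
    exact_mod_cast vDen_pos K (s := ⟨s, hs⟩) hw
  have h4 : (vNum (inputMem K) w s : ℚ) ≤ K.maxUpper * vDen (inputMem K) w s :=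
    h3.trans (mul_le_mul_of_nonneg_right (K.U_le_maxUpper _) hD.le)
  have h5 := mul_le_mul_of_nonneg_right h4 hwt.le
  have e1 := inputMem_w K ⟨s, hs⟩
  have e2 := scale_eq K w ⟨s, hs⟩
  simp only at e1 e2
  rw [e1, e2, Int.cast_natCast]
  linarith

/-- The integer test is the comparison of true gains multiplied by the positive denominators of both
items. -/
theorem sel_eq_topBefore (w s : ℤ) (j : Fin K.n) : sel K w s (j : ℕ) =
    topBefore (fun i => K.excess (scale K w s) (vNum (inputMem K) w s) ∅ i
      - K.excess (scale K w s) (vNum (inputMem K) w s) Finset.univ i) j := by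
  ext i
  have hi : (0 : ℚ) < den (inputMem K) (i : ℕ) := by exact_mod_cast den_pos K i
  have hj : (0 : ℚ) < den (inputMem K) (j : ℕ) := by exact_mod_cast den_pos K j
  simp only [sel, topBefore, Finset.mem_filter, Finset.mem_univ, true_and, inc_eq, ← exU_div_den,
    ← exP_div_den, ← sub_div, ite_eq_left_iff, zero_ne_one, imp_false, not_not]
  rw [div_lt_div_iff₀ hj hi, div_eq_div_iff hi.ne' hj.ne']
  simp only [gain, Nat.cast_lt, Fin.val_fin_lt]
  norm_cast

/-- Completeness of the search: at the critical density of `Q` the test depends on the queried set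
only through its total gain, and the greedy set of the same size gains at least as much. -/
theorem exists_pass {Q : Finset (Fin K.n)} (hQ : K.IsFeasible Q) (hcard : Q.card < K.n) :
    ∃ w s j : ℕ, w < 3 ∧ s < K.n ∧ j < K.n ∧ Pass K w s j ∧ (sel K w s j).card = Q.card := by
  obtain ⟨s, v, hv, hV⟩ := K.exists_sum_excess_le hQ (by omega)
  obtain ⟨w, hw, hN⟩ := exists_vNum_eq K hv
  have hD : (0 : ℚ) < vDen (inputMem K) w (s : ℕ) := by
    exact_mod_cast vDen_pos K (s := s) hw
  have h := hV _ hD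
  rw [← hN, ← scale_eq] at h
  set c := scale K w (s : ℕ)
  set N : ℚ := ↑(vNum (inputMem K) w (s : ℕ))
  have hc : 0 < c := scale_pos K hw s
  set g : Fin K.n → ℚ := fun i => K.excess c N ∅ i - K.excess c N Finset.univ i with hg
  have hg0 : ∀ i, 0 ≤ g i := fun i => by
    have h1 : K.upper Finset.univ i ≤ K.upper ∅ i := by
      simpa [Instance.upper] using K.p_le_U i
    have := mul_le_mul_of_nonneg_left h1 hc.le
    exact sub_nonneg.2 (max_le_max le_rfl (by linarith))
  obtain ⟨j, hj⟩ := exists_card_topBefore g hcard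
  have hsel : sel K w (s : ℕ) (j : ℕ) = topBefore g j := sel_eq_topBefore K w (s : ℕ) j
  have hsum : ∀ A : Finset (Fin K.n), ∑ i, K.excess c N A i
      = ∑ i, K.excess c N ∅ i - ∑ i ∈ A, g i := fun A => by
    rw [← Finset.sum_ite_mem_eq A, ← Finset.sum_sub_distrib]
    refine Finset.sum_congr rfl fun i _ => ?_
    rw [excess_eq_ite]
    split_ifs <;> simp [hg]
  refine ⟨w, s, j, hw, s.2, j.2, ?_, by rw [hsel, hj]⟩
  rw [Pass, total_eq, inputMem_w, Int.cast_natCast, hsel]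
  have := sum_le_sum_topBefore hg0 hj.ge
  change N * _ + ∑ i, K.excess c N _ i ≤ K.D * c
  rw [hsum] at h ⊢
  linarith

/-- The index `j = n` points past the end of the input, where memory is zero. Both sides of every
cross-multiplied comparison are then 0, so each item ties with `j` and is selected because its index
is smaller. -/
theorem sel_default : sel K 0 0 K.n = Finset.univ := by
  refine Finset.filter_true_of_mem fun i _ => ?_
  have h : ∀ k : ℕ, 4 ≤ k → inputMem K (8 * (K.n : ℤ) + k) = 0 := fun k hk => by
    have := inputMem_of_le K (k := 8 * K.n + k) (by omega)
    exact_mod_cast this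
  have h6 := h 6 (by decide)
  have h10 := h 10 (by decide)
  push_cast at h6 h10
  rw [inc_eq, if_pos]
  right
  simp [gain, exU, exP, den, h6, h10]

/-! ### Correctness of the search -/

variable (K : PrefixInstance)

/-- States during the search: registers 8 to 11 describe an acceptable set and its cardinality. -/
structure Accepting (σ : State) : Prop where
  sane : Sane (inputMem K) K.n (inputSize K.encode) σ
  value_le : K.prefixValue (sel K (σ.reg 8) (σ.reg 9) (σ.reg 10)) ≤ K.D + 2 * K.maxUpper
  card_eq : σ.reg 11 = (sel K (σ.reg 8) (σ.reg 9) (σ.reg 10)).card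

theorem Accepting.bdd {σ : State} (h : Accepting K σ) :
    Bdd (bitBound (inputSize K.encode)) σ := h.sane.bdd (input_inputMem K)

theorem Accepting.setReg {σ : State} (h : Accepting K σ) {r : ℕ} {z : ℤ}
    (hr : r ∈ ({1, 2, 3} : Finset ℕ)) (h0 : 0 ≤ z) (hz : z ≤ (K.n + 3 : ℕ)) :
    Accepting K (σ.setReg r z) := by
  simp only [Finset.mem_insert, Finset.mem_singleton] at hr
  refine ⟨h.sane.setReg (by omega) (by omega) (by omega) h0 hz, ?_, ?_⟩
  · have := h.value_le
    rcases hr with rfl | rfl | rfl <;> simpa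
  · have := h.card_eq
    rcases hr with rfl | rfl | rfl <;> simpa

theorem eval_passE_ne_zero {σ : State} {w s j : ℕ} (hm : σ.mem 0 = inputMem K)
    (h1 : σ.reg 1 = w) (h2 : σ.reg 2 = s) (h6 : 0 < σ.reg 6)
    (h5 : (σ.reg 5 : ℚ) = σ.reg 6 * total (inputMem K) w s j K.n) :
    passE.eval σ ≠ 0 ↔ Pass K w s j := by
  obtain ⟨-, hB, hN, hD⟩ := inputMem_header K
  have h6' : (0 : ℚ) < σ.reg 6 := by exact_mod_cast h6
  have hd : (0 : ℚ) < K.D.den := by exact_mod_cast K.D.den_pos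
  have e : passE.eval σ ≠ 0 ↔
      vNum (inputMem K) w s * (K.B - inputMem K (8 * s + 4)) * σ.reg 6 * K.D.den
        + σ.reg 5 * K.D.den
      ≤ K.D.num * (inputMem K (8 * s + 4) * vDen (inputMem K) w s) * σ.reg 6 := by
    simp [passE, eval_vNumE, eval_vDenE, hm, h1, h2, hB, hN, hD]
  -- Clear the positive denominators of the accumulated fraction and of `D`.
  rw [e, Pass, scale, ← mul_le_mul_iff_left₀ (mul_pos h6' hd), ← @Int.cast_le ℚ]
  push_cast
  rw [h5, ← Rat.mul_den_eq_num K.D]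
  constructor <;> intro h <;> linarith

/-- What remains of the state after the set selected by registers 1 to 3 has been compared with
the best one. -/
structure Updated (σ₀ : State) (w s j : ℕ) (σ : State) : Prop where
  acc : Accepting K σ
  le : σ.reg 11 ≤ σ₀.reg 11
  reg_one : σ.reg 1 = w
  reg_two : σ.reg 2 = s
  reg_three : σ.reg 3 = j
  best : Pass K w s j → σ.reg 11 ≤ (sel K w s j).card

theorem runs_compare {σ : State} (h : Accepting K σ) {w s j : ℕ} (hw : w < 3) (hs : s < K.n)
    (h1 : σ.reg 1 = w) (h2 : σ.reg 2 = s) (h3 : σ.reg 3 = j) :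
    Runs (bitBound (inputSize K.encode)) (inputSize K.encode) (.seq evalSet update) σ
      (Updated K σ w s j) := by
  have hI := input_inputMem K
  refine Runs.seq ((runs_evalSet hI h.sane).mono fun τ hτ => ?_)
  have f : ∀ r, r ≠ 4 → r ≠ 5 → r ≠ 6 → r ≠ 7 → τ.reg r = σ.reg r := hτ.frame
  have f1 : τ.reg 1 = w := by rw [f 1 (by decide) (by decide) (by decide) (by decide), h1]
  have f2 : τ.reg 2 = s := by rw [f 2 (by decide) (by decide) (by decide) (by decide), h2]
  have f3 : τ.reg 3 = j := by rw [f 3 (by decide) (by decide) (by decide) (by decide), h3]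
  have f8 := f 8 (by decide) (by decide) (by decide) (by decide)
  have f9 := f 9 (by decide) (by decide) (by decide) (by decide)
  have f10 := f 10 (by decide) (by decide) (by decide) (by decide)
  have f11 := f 11 (by decide) (by decide) (by decide) (by decide)
  have hcount := hτ.count_eq
  have htot := hτ.total_eq
  rw [h1, h2, h3, count_eq_card] at hcount
  rw [h1, h2, h3] at htot
  have hpass := eval_passE_ne_zero K hτ.sane.mem_zero f1 f2 hτ.den_pos htot
  have hless := eval_lessE_ne_zero τ (.reg 7) (.reg 11)
  refine Runs.ite (hτ.sane.bdd hI) (fun hne => ?_) (fun heq => ?_)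
  · rw [eval_mul, mul_ne_zero_iff, hpass, hless] at hne
    obtain ⟨hP, hlt⟩ := hne
    have hlt : τ.reg 7 < τ.reg 11 := hlt
    have g := fun r h5 h6 => hτ.sane.reg_small r h5 h6
    have s1 := hτ.sane.setReg (r := 8) (by decide) (by decide) (by decide)
      (g 1 (by decide) (by decide)).1 (g 1 (by decide) (by decide)).2
    have s2 := s1.setReg (r := 9) (by decide) (by decide) (by decide)
      (g 2 (by decide) (by decide)).1 (g 2 (by decide) (by decide)).2
    have s3 := s2.setReg (r := 10) (by decide) (by decide) (by decide)
      (g 3 (by decide) (by decide)).1 (g 3 (by decide) (by decide)).2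
    have s4 := s3.setReg (r := 11) (by decide) (by decide) (by decide)
      (g 7 (by decide) (by decide)).1 (g 7 (by decide) (by decide)).2
    refine Runs.seq (Runs.assign (hτ.sane.bdd hI) ?_)
    refine Runs.seq (Runs.assign (s1.bdd hI) ?_)
    refine Runs.seq (Runs.assign (s2.bdd hI) ?_)
    refine Runs.assign (s3.bdd hI) ⟨⟨s4, ?_, ?_⟩, ?_, ?_, ?_, ?_, ?_⟩
    · simpa [f1, f2, f3] using hP.prefixValue_le K hw hs
    · simpa [f1, f2, f3] using hcount
    · simpa [← f11] using hlt.le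
    · simpa using f1
    · simpa using f2
    · simpa using f3
    · intro _; simp [hcount]
  · refine Runs.skip ⟨⟨hτ.sane, ?_, ?_⟩, f11.le, f1, f2, f3, fun hP => ?_⟩
    · rw [f8, f9, f10]; exact h.value_le
    · rw [f8, f9, f10, f11]; exact h.card_eq
    · rw [eval_mul, mul_eq_zero] at heq
      rcases heq with heq | heq
      · exact absurd heq (hpass.2 hP)
      · rw [← hcount]
        by_contra hlt
        exact hless.2 (not_le.1 hlt) heq

/-- Invariant of the search: `P` describes the triples that have been examined. -/
structure Searched (c : ℤ) (P : ℕ → ℕ → ℕ → Prop) (σ : State) : Prop where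
  acc : Accepting K σ
  le : σ.reg 11 ≤ c
  best : ∀ w s j, P w s j → Pass K w s j → σ.reg 11 ≤ (sel K w s j).card

theorem Searched.setReg {c : ℤ} {P : ℕ → ℕ → ℕ → Prop} {σ : State} (h : Searched K c P σ) {r : ℕ}
    {z : ℤ} (hr : r ∈ ({1, 2, 3} : Finset ℕ)) (h0 : 0 ≤ z) (hz : z ≤ (K.n + 3 : ℕ)) :
    Searched K c P (σ.setReg r z) := by
  have hr' : (11 : ℕ) ≠ r := by rintro rfl; revert hr; decide
  exact ⟨h.acc.setReg K hr h0 hz, by simpa [hr'] using h.le, by simpa [hr'] using h.best⟩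

theorem Searched.mono {c : ℤ} {P P' : ℕ → ℕ → ℕ → Prop} {σ : State} (h : Searched K c P σ)
    (hP : ∀ w s j, P' w s j → P w s j) : Searched K c P' σ :=
  ⟨h.acc, h.le, fun w s j hj => h.best w s j (hP w s j hj)⟩

theorem n_add_four_le : K.n + 4 ≤ inputSize K.encode := (input_inputMem K).n_le

/-- The predicate `P` of triples already examined is left arbitrary so that the loops nest. Old
triples stay covered because register 11 never increases. -/
theorem runs_loopJ {c : ℤ} {P : ℕ → ℕ → ℕ → Prop} {σ : State} {w s : ℕ} (h : Searched K c P σ)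
    (hw : w < 3) (hs : s < K.n) (h1 : σ.reg 1 = w) (h2 : σ.reg 2 = s) :
    Runs (bitBound (inputSize K.encode)) (inputSize K.encode) loopJ σ fun τ =>
      Searched K c (fun w' s' j' => P w' s' j' ∨ (w' = w ∧ s' = s ∧ j' < K.n)) τ ∧
        τ.reg 1 = w ∧ τ.reg 2 = s := by
  have hS := n_add_four_le K
  refine Runs.seq (Runs.assign h.acc.bdd ?_)
  refine (Runs.loop (n := K.n) (by omega) (I := fun k τ =>
    Searched K c (fun w' s' j' => P w' s' j' ∨ (w' = w ∧ s' = s ∧ j' < k)) τ ∧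
      τ.reg 1 = w ∧ τ.reg 2 = s ∧ τ.reg 3 = k) ?_ ?_ ?_).mono fun τ hτ => ⟨hτ.1, hτ.2.1, hτ.2.2.1⟩
  · rintro k hk τ ⟨hτ, -, -, t3⟩
    refine ⟨hτ.acc.bdd, ?_⟩
    rw [eval_lessE_ne_zero]
    simp [t3, hτ.acc.sane.reg_zero]
  · rintro k hk τ ⟨hτ, t1, t2, t3⟩
    refine Runs.seq ((runs_compare K hτ.acc hw hs t1 t2 t3).mono fun υ hυ => ?_)
    refine Runs.assign hυ.acc.bdd ?_
    have e : (Expr.reg 3 + 1).eval υ = k + 1 := by simp [hυ.reg_three]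
    rw [e]
    have hυ' : Searched K c (fun w' s' j' => P w' s' j' ∨ (w' = w ∧ s' = s ∧ j' < k + 1)) υ := by
      refine ⟨hυ.acc, hυ.le.trans hτ.le, fun w' s' j' hj hp => ?_⟩
      by_cases hc : w' = w ∧ s' = s ∧ j' = k
      · obtain ⟨rfl, rfl, rfl⟩ := hc
        exact hυ.best hp
      · exact hυ.le.trans (hτ.best w' s' j' (hj.imp_right fun _ => by omega) hp)
    exact ⟨hυ'.setReg K (by decide) (by omega) (by push_cast; omega), by simpa using hυ.reg_one,
      by simpa using hυ.reg_two, by simp⟩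
  · exact ⟨(h.mono K (by simp)).setReg K (by decide) (by simp) (by simp; positivity), by simpa,
      by simpa, by simp⟩

theorem runs_loopS {c : ℤ} {P : ℕ → ℕ → ℕ → Prop} {σ : State} {w : ℕ} (h : Searched K c P σ)
    (hw : w < 3) (h1 : σ.reg 1 = w) :
    Runs (bitBound (inputSize K.encode)) (inputSize K.encode) loopS σ fun τ =>
      Searched K c (fun w' s' j' => P w' s' j' ∨ (w' = w ∧ s' < K.n ∧ j' < K.n)) τ ∧
        τ.reg 1 = w := by
  have hS := n_add_four_le K
  refine Runs.seq (Runs.assign h.acc.bdd ?_)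
  refine (Runs.loop (n := K.n) (by omega) (I := fun k τ =>
    Searched K c (fun w' s' j' => P w' s' j' ∨ (w' = w ∧ s' < k ∧ j' < K.n)) τ ∧
      τ.reg 1 = w ∧ τ.reg 2 = k) ?_ ?_ ?_).mono fun τ hτ => ⟨hτ.1, hτ.2.1⟩
  · rintro k hk τ ⟨hτ, -, t2⟩
    refine ⟨hτ.acc.bdd, ?_⟩
    rw [eval_lessE_ne_zero]
    simp [t2, hτ.acc.sane.reg_zero]
  · rintro k hk τ ⟨hτ, t1, t2⟩
    refine Runs.seq ((runs_loopJ K hτ hw hk t1 t2).mono ?_)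
    rintro υ ⟨hυ, u1, u2⟩
    refine Runs.assign hυ.acc.bdd ?_
    have e : (Expr.reg 2 + 1).eval υ = k + 1 := by simp [u2]
    rw [e]
    refine ⟨(hυ.mono K ?_).setReg K (by decide) (by omega) (by push_cast; omega), by simpa,
      by simp⟩
    rintro w' s' j' (hj | ⟨h1, h2, h3⟩)
    · exact Or.inl (Or.inl hj)
    · rcases Nat.lt_succ_iff_lt_or_eq.1 h2 with h2 | h2
      exacts [Or.inl (Or.inr ⟨h1, h2, h3⟩), Or.inr ⟨h1, h2, h3⟩]
  · exact ⟨(h.mono K (by simp)).setReg K (by decide) (by simp) (by simp; positivity), by simpa,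
      by simp⟩

theorem runs_loopW {c : ℤ} {σ : State} (h : Searched K c (fun _ _ _ => False) σ) :
    Runs (bitBound (inputSize K.encode)) (inputSize K.encode) loopW σ
      (Searched K c fun w s j => w < 3 ∧ s < K.n ∧ j < K.n) := by
  have hS := n_add_four_le K
  refine Runs.seq (Runs.assign h.acc.bdd ?_)
  refine (Runs.loop (n := 3) (by omega) (I := fun k τ =>
    Searched K c (fun w s j => w < k ∧ s < K.n ∧ j < K.n) τ ∧ τ.reg 1 = k) ?_ ?_ ?_).mono
      fun τ hτ => hτ.1
  · rintro k hk τ ⟨hτ, t1⟩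
    refine ⟨hτ.acc.bdd, ?_⟩
    rw [eval_lessE_ne_zero]
    simp [t1]
  · rintro k hk τ ⟨hτ, t1⟩
    refine Runs.seq ((runs_loopS K hτ hk t1).mono ?_)
    rintro υ ⟨hυ, u1⟩
    refine Runs.assign hυ.acc.bdd ?_
    have e : (Expr.reg 1 + 1).eval υ = k + 1 := by simp [u1]
    rw [e]
    refine ⟨(hυ.mono K ?_).setReg K (by decide) (by omega) (by push_cast; omega), by simp⟩
    intro w' s' j' hj
    omega
  · exact ⟨(h.mono K (by simp)).setReg K (by decide) (by simp) (by simp; positivity), by simp⟩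

/-- The initial state need not satisfy `Sane`, since register 0 holds the list length instead of
`n`; the first assignment needs a bound of its own. -/
theorem load_bdd (l : List ℤ) (hl : l ≠ []) : Bdd (bitBound (inputSize l)) (load l) := by
  have h1 := length_le_inputSize l
  have h0 : 0 < l.length := List.length_pos_iff.2 hl
  have hS : inputSize l + 2 ≤ bitBound (inputSize l) := by rw [bitBound]; omega
  constructor
  · intro r
    refine (bits_le_of_nonneg_of_le (k := l.length) ?_ ?_).trans (by omega) <;>
      simp only [load] <;> split_ifs <;> simp
  · intro a k
    simp only [load]
    split_ifs
    · by_cases hk : k.toNat < l.length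
      · rw [List.getD_eq_getElem _ _ hk]
        exact (bits_le_inputSize (List.getElem_mem hk)).trans (by omega)
      · rw [List.getD_eq_default _ _ (not_lt.1 hk)]
        simp [bits]; omega
    · simp [bits]; omega

theorem output_eq (σ : State) :
    output σ = (List.range (σ.reg 0).toNat).map fun k : ℕ => σ.mem 1 (k : ℤ) := by
  simp only [output, List.pure_def, List.bind_eq_flatMap, List.map_flatMap, List.map_singleton]
  exact List.flatMap_pure_eq_map _ _

/-- The output of the program is a set that is no larger than any feasible solution and violates
the threshold by at most twice the maximum upper limit. -/
def Solves (o : List ℤ) : Prop :=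
  ∃ Q : Finset (Fin K.n), o = K.encodeSet Q ∧
    (∀ Q', K.IsFeasible Q' → Q.card ≤ Q'.card) ∧ K.prefixValue Q ≤ K.D + 2 * K.maxUpper

theorem runs_main :
    Runs (bitBound (inputSize K.encode)) (inputSize K.encode) main (load K.encode)
      fun σ => Solves K (output σ) := by
  have hI := input_inputMem K
  have hS := n_add_four_le K
  have hb0 : Bdd (bitBound (inputSize K.encode)) (load K.encode) :=
    load_bdd _ (by simp [PrefixInstance.encode])
  have hz : bits 0 ≤ bitBound (inputSize K.encode) := by simpa [bits] using hb0.one_le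
  have e0 : (Expr.cell 0 0).eval (load K.encode) = K.n := (inputMem_header K).1
  have s1 : Sane (inputMem K) K.n (inputSize K.encode) ((load K.encode).setReg 0 K.n) := by
    refine ⟨rfl, ?_, ?_, by simp, ?_, ?_, ?_⟩
    · intro k; simp [load]
    · intro a ha k
      have : a ≠ 0 := by omega
      simp [load, this]
    · intro r _ _
      by_cases hr : r = 0
      · simp [hr]
      · simp [load, hr]; positivity
    · simpa [load] using hz
    · simpa [load] using hz
  have s2 := s1.setReg (r := 10) (z := K.n) (by decide) (by decide) (by decide) (by simp) (by simp)
  have s3 := s2.setReg (r := 11) (z := K.n) (by decide) (by decide) (by decide) (by simp) (by simp)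
  refine Runs.seq (Runs.assign hb0 ?_)
  rw [e0]
  refine Runs.seq (Runs.assign (s1.bdd hI) ?_)
  rw [eval_reg, s1.reg_zero]
  refine Runs.seq (Runs.assign (s2.bdd hI) ?_)
  rw [eval_reg, s2.reg_zero]
  have hstart : Searched K K.n (fun _ _ _ => False)
      ((((load K.encode).setReg 0 K.n).setReg 10 K.n).setReg 11 K.n) := by
    refine ⟨⟨s3, ?_, ?_⟩, by simp, by simp⟩
    -- The default set queries everything, so its prefix is a packing and has value at most `D`.
    · have h1 := K.prefixValue_univ_le
      have h2 := K.maxUpper_nonneg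
      simp [load, sel_default]
      linarith
    · simp [load, sel_default]
  refine Runs.seq ((runs_loopW K hstart).mono fun τ hτ => ?_)
  have g := hτ.acc.sane.reg_small
  have a1 := hτ.acc.setReg K (r := 1) (by decide) (g 8 (by decide) (by decide)).1
    (g 8 (by decide) (by decide)).2
  have a2 := a1.setReg K (r := 2) (by decide) (g 9 (by decide) (by decide)).1
    (g 9 (by decide) (by decide)).2
  have a3 := a2.setReg K (r := 3) (by decide) (g 10 (by decide) (by decide)).1
    (g 10 (by decide) (by decide)).2
  refine Runs.seq (Runs.assign hτ.acc.bdd ?_)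
  refine Runs.seq (Runs.assign a1.bdd ?_)
  refine Runs.seq (Runs.assign a2.bdd ?_)
  refine (runs_evalSet hI a3.sane).mono fun υ hυ => ?_
  refine ⟨sel K (τ.reg 8) (τ.reg 9) (τ.reg 10), ?_, fun Q hQ => ?_, hτ.acc.value_le⟩
  · refine List.ext_getElem ?_ fun k hk hk' => ?_
    · simp [output_eq, PrefixInstance.encodeSet, hυ.sane.reg_zero]
    · have hkn : k < K.n := by simpa [PrefixInstance.encodeSet] using hk'
      have ho := hυ.output k hkn
      simp at ho
      simp only [output_eq, List.getElem_map, List.getElem_range, ho, PrefixInstance.encodeSet,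
        List.getElem_ofFn, sel, Finset.mem_filter, Finset.mem_univ, true_and]
      rcases inc_eq_zero_or_one (inputMem K) (τ.reg 8) (τ.reg 9) (τ.reg 10) k with h | h <;>
        simp [h]
  · have hcard := hτ.acc.card_eq
    rcases lt_or_ge Q.card K.n with hlt | hge
    · obtain ⟨w, s, j, hw, hs, hj, hP, he⟩ := exists_pass K hQ hlt
      have := hτ.best w s j ⟨hw, hs, hj⟩ hP
      omega
    -- No smaller set is needed here: the cardinality register started at `n` and never increased.
    · have := hτ.le
      omega

end KnapExp.PrefixProgram

/-! ### The main theorem -/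

theorem mainTheorem9 :
    RAM.PolyTimeSolvable KnapExp.PrefixInstance.encode
      (fun (K : KnapExp.PrefixInstance) (o : List ℤ) =>
        ∃ Q : Finset (Fin K.n), o = K.encodeSet Q ∧
          (∀ Qopt : Finset (Fin K.n), K.IsOptimal Qopt → Q.card ≤ Qopt.card) ∧
          K.prefixValue Q ≤ K.D + 2 * K.maxUpper) := by
  open KnapExp.PrefixProgram in
  -- The polynomial is `bitBound` with the input size as the variable; its coefficients depend on
  -- the program only.
  obtain ⟨q, hq⟩ := RAM.Prog.exists_polynomial_time
    (.C (termE.factor + (denE (.reg 4)).factor) * .X * .X + .X + 2 + .X) main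
  refine ⟨KnapExp.PrefixProgram.main, q, fun K => ?_⟩
  obtain ⟨σ, t, he, ht, Q, ho, hcard, hval⟩ := KnapExp.PrefixProgram.runs_main K
  refine ⟨σ, t, he, ?_, Q, ho, fun Q' hQ' => hcard Q' hQ'.1, hval⟩
  rw [hq]
  convert ht using 2
  simp [KnapExp.PrefixProgram.bitBound, KnapExp.PrefixProgram.growth]
  ring
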